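/- Let $a_1,\dots,a_n$ be the annihilation operators on $\bigotimes_{j=1}^n \ell_2$, and let $\mathfrak a=(a_1,\dots,a_n,a_1^\dagger,\dots,a_n^\dagger)^T$, with $[a_i,a_j^\dagger]=\delta_{ij}$. For a density operator $\rho$ write $\langle A\rangle=\operatorname{tr}(A\rho)$. Let $\rho$ be a Gaussian state with mean $\mu\in\mathbb C^{2n}$ and (symmetric) covariance matrix $C\in\mathbb C^{2n\times 2n}$, i.e. its characteristic function is $$\operatorname{tr}\bigl(e^{i\mathbf z^T\mathfrak a}\rho\bigr)=\exp\Bigl((i\mathbf z)^T\mu+\tfrac12(i\mathbf z)^TC(i\mathbf z)\Bigr)\quad\text{for all } \mathbf z=(z_1,\dots,z_n,\overline z_1,\dots,\overline z_n)^T,\ z\in\mathbb C^n .$$ Then all products of components of $\mathfrak a$ have an expectation in $\rho$ (their product with $\rho$ is everywhere defined and of trace class), $\langle\mathfrak a_k\rangle=\mu_k$ for all labels $k\in\{1,\dots,2n\}$, the matrix of second central moments $D_{kl}=\langle\mathfrak a_k\mathfrak a_l\rangle-\langle\mathfrak a_k\rangle\langle\mathfrak a_l\rangle$ equals $C-\tfrac12J$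 with $J=\begin{pmatrix}0&-I_n\\ I_n&0\end{pmatrix}$, and for every finite set $I\subset\mathbb N$ $$\langle \mathfrak a_I\rangle=\sum_{I=I_1\sqcup I_2}\mu_{I_1}D_{I_2}$$ as tensors with one factor $\mathbb C^{2n}$ for each element of $I$. That is, for every choice of labels $\kappa_j\in\{1,\dots,2n\}$, $j\in I$, the components are $\mathfrak a_I=\prod_{j\in I}\mathfrak a_{\kappa_j}$ (factors in ascending order of $j$), $\mu_{I_1}=\prod_{j\in I_1}\mu_{\kappa_j}$, and $D_{I_2}=\sum_{I_2=p_1\sqcup\dots\sqcup p_r}D_{p_1}\cdots D_{p_r}$, the sum over all partitions of $I_2$ into pairs (so $D_{I_2}=0$ if $|I_2|$ is odd and $D_\emptyset=1$), where $D_p=D_{\kappa_i\kappa_j}$ for $p=\{i,j\}$, $i<j$. The outer sum runs over all ordered pairs of disjoint, possibly empty sets $I_1,I_2$ with union $I$. -/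

import Mathlib

open scoped ComplexConjugate InnerProductSpace

noncomputable section

/-- The Hilbert space `⊗_{j=1}^n ℓ²`, realised as `ℓ²(ℕⁿ)`: the coordinate of a vector at
`l : Fin n → ℕ` is its coefficient at the number state `|l₁, …, lₙ⟩`. -/
abbrev Fock (n : ℕ) : Type := lp (fun _ : Fin n → ℕ => ℂ) 2

namespace Fock

/-- The `2n` labels of `𝔞 = (a₁, …, aₙ, a₁†, …, aₙ†)`. -/
abbrev Idx (n : ℕ) : Type := Fin n ⊕ Fin n

/-- The number state `|l⟩`. -/
def ket {n : ℕ} (l : Fin n → ℕ) : Fock n := lp.single 2 l 1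

/-- The action of `a_j` on coefficient sequences:
`a_j |l⟩ = √l_j |l - e_j⟩`, i.e. `(a_j ψ)(l) = √(l_j + 1) ψ(l + e_j)`. -/
def annihilate {n : ℕ} (j : Fin n) : ((Fin n → ℕ) → ℂ) →ₗ[ℂ] ((Fin n → ℕ) → ℂ) where
  toFun ψ l := (Real.sqrt (l j + 1) : ℂ) * ψ (l + Pi.single j 1)
  map_add' ψ φ := by ext l; simp [mul_add]
  map_smul' c ψ := by ext l; simp; ring

/-- The action of `a_j†` on coefficient sequences:
`a_j† |l⟩ = √(l_j + 1) |l + e_j⟩`, i.e. `(a_j† ψ)(l) = √l_j ψ(l - e_j)`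
(which is `0` when `l_j = 0`). -/
def create {n : ℕ} (j : Fin n) : ((Fin n → ℕ) → ℂ) →ₗ[ℂ] ((Fin n → ℕ) → ℂ) where
  toFun ψ l := (Real.sqrt (l j) : ℂ) * ψ (l - Pi.single j 1)
  map_add' ψ φ := by ext l; simp [mul_add]
  map_smul' c ψ := by ext l; simp; ring

/-- The components of `𝔞`, acting on coefficient sequences. -/
def ladder {n : ℕ} : Idx n → ((Fin n → ℕ) → ℂ) →ₗ[ℂ] ((Fin n → ℕ) → ℂ) :=
  Sum.elim annihilate create

/-- The components of `𝔞` as (closed) unbounded operators on the Hilbert space, with their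
maximal domains. -/
def ladderOp {n : ℕ} (k : Idx n) : Fock n →ₗ.[ℂ] Fock n where
  domain :=
    { carrier := {ψ | Memℓp (ladder k ψ) 2}
      add_mem' := fun {ψ φ} hψ hφ => by
        have h : ladder k ((ψ + φ : Fock n) : (Fin n → ℕ) → ℂ) = ladder k ψ + ladder k φ := by
          rw [← map_add]; rfl
        simpa only [Set.mem_ofPred_eq, h] using Memℓp.add hψ hφ
      zero_mem' := by
        have h : ladder k ((0 : Fock n) : (Fin n → ℕ) → ℂ) = 0 := by
          rw [lp.coeFn_zero]; exact map_zero _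
        simpa only [Set.mem_ofPred_eq, h] using zero_memℓp
      smul_mem' := fun c ψ hψ => by
        have h : ladder k ((c • ψ : Fock n) : (Fin n → ℕ) → ℂ) = c • ladder k ψ := by
          rw [← map_smul]; rfl
        simpa only [Set.mem_ofPred_eq, h] using Memℓp.const_smul hψ c }
  toFun :=
    { toFun := fun ψ => ⟨ladder k (ψ : Fock n), ψ.2⟩
      map_add' := fun ψ φ => by
        ext1
        exact map_add (ladder k) ((ψ : Fock n) : (Fin n → ℕ) → ℂ) ((φ : Fock n) : (Fin n → ℕ) → ℂ)
      map_smul' := fun c ψ => by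
        ext1
        exact map_smul (ladder k) c ((ψ : Fock n) : (Fin n → ℕ) → ℂ) }

/-- The product `g f` of unbounded operators, with its natural domain
`{ψ ∈ dom f | f ψ ∈ dom g}`. -/
def opMul {n : ℕ} (g f : Fock n →ₗ.[ℂ] Fock n) : Fock n →ₗ.[ℂ] Fock n where
  domain :=
    { carrier := {ψ | ∃ h : ψ ∈ f.domain, f ⟨ψ, h⟩ ∈ g.domain}
      add_mem' := fun {ψ φ} ⟨h₁, h₂⟩ ⟨h₃, h₄⟩ =>
        ⟨add_mem h₁ h₃, by
          have := f.map_add ⟨ψ, h₁⟩ ⟨φ, h₃⟩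
          exact this ▸ add_mem h₂ h₄⟩
      zero_mem' := ⟨zero_mem _, by
          have h : f ⟨0, zero_mem f.domain⟩ = 0 := f.map_zero
          rw [h]
          exact zero_mem g.domain⟩
      smul_mem' := fun c ψ ⟨h₁, h₂⟩ =>
        ⟨f.domain.smul_mem c h₁, by
          have := f.map_smul c ⟨ψ, h₁⟩
          exact this ▸ g.domain.smul_mem c h₂⟩ }
  toFun :=
    { toFun := fun ψ => g ⟨f ⟨ψ, ψ.2.1⟩, ψ.2.2⟩
      map_add' := fun ψ φ => by
        rw [← g.map_add]
        congr 1
        exact Subtype.ext (f.map_add ⟨ψ, ψ.2.1⟩ ⟨φ, φ.2.1⟩)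
      map_smul' := fun c ψ => by
        rw [RingHom.id_apply, ← g.map_smul]
        congr 1
        exact Subtype.ext (f.map_smul c ⟨ψ, ψ.2.1⟩) }

/-- The operator product `𝔞_{k₁} 𝔞_{k₂} ⋯ 𝔞_{kₘ}` for a list `[k₁, …, kₘ]`
(the identity for the empty list). -/
def ladderProd {n : ℕ} : List (Idx n) → (Fock n →ₗ.[ℂ] Fock n)
  | [] => (LinearMap.id : Fock n →ₗ[ℂ] Fock n).toPMap ⊤
  | k :: w => opMul (ladderOp k) (ladderProd w)

/-! ### Trace class operators, density operators, expectations -/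

/-- Trace class operators: `T = ∑ᵢ ⟨xᵢ, ·⟩ yᵢ` with `∑ᵢ ‖xᵢ‖ ‖yᵢ‖ < ∞`. -/
def IsTraceClass {n : ℕ} (T : Fock n →L[ℂ] Fock n) : Prop :=
  ∃ x y : ℕ → Fock n, Summable (fun i => ‖x i‖ * ‖y i‖) ∧
    ∀ ψ, HasSum (fun i => ⟪x i, ψ⟫_ℂ • y i) (T ψ)

/-- The trace of a trace class operator. -/
def trace {n : ℕ} (T : Fock n →L[ℂ] Fock n) : ℂ := ∑' l : Fin n → ℕ, ⟪ket l, T (ket l)⟫_ℂ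

/-- Density operators (states). -/
structure IsDensityOperator {n : ℕ} (ρ : Fock n →L[ℂ] Fock n) : Prop where
  isPositive : ρ.IsPositive
  isTraceClass : IsTraceClass ρ
  trace_eq_one : trace ρ = 1

/-- `⟨A⟩ = tr (A ρ)` exists and equals `c`: the operator `A ρ` is everywhere defined, bounded and
of trace class, with trace `c`. -/
def HasExpectation {n : ℕ} (ρ : Fock n →L[ℂ] Fock n) (A : Fock n →ₗ.[ℂ] Fock n) (c : ℂ) : Prop :=
  ∃ T : Fock n →L[ℂ] Fock n,
    (∀ ψ, ∃ h : ρ ψ ∈ A.domain, A ⟨ρ ψ, h⟩ = T ψ) ∧ IsTraceClass T ∧ trace T = c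

open Classical in
/-- The expectation `⟨A⟩ = tr (A ρ)` (with value `0` if it does not exist). -/
def expectation {n : ℕ} (ρ : Fock n →L[ℂ] Fock n) (A : Fock n →ₗ.[ℂ] Fock n) : ℂ :=
  if h : ∃ c, HasExpectation ρ A c then h.choose else 0

/-- The vector of first moments `μ = ⟨𝔞⟩`. -/
def mean {n : ℕ} (ρ : Fock n →L[ℂ] Fock n) (k : Idx n) : ℂ :=
  expectation ρ (ladderProd [k])

/-- The matrix of second central moments `D_{kl} = ⟨𝔞_k 𝔞_l⟩ - ⟨𝔞_k⟩⟨𝔞_l⟩`. -/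
def secondCentralMoments {n : ℕ} (ρ : Fock n →L[ℂ] Fock n) : Matrix (Idx n) (Idx n) ℂ :=
  Matrix.of fun k l => expectation ρ (ladderProd [k, l]) - mean ρ k * mean ρ l

/-! ### The operators `exp (i 𝐳ᵀ 𝔞)` -/

/-- The vector `𝐳 = (z₁, …, zₙ, z̄₁, …, z̄ₙ)`. -/
def bar {n : ℕ} (z : Fin n → ℂ) : Idx n → ℂ := Sum.elim z (fun j => conj (z j))

/-- The linear form `𝐳ᵀ 𝔞 = ∑ⱼ (zⱼ aⱼ + z̄ⱼ aⱼ†)`, acting on coefficient sequences. -/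
def field {n : ℕ} (z : Fin n → ℂ) : ((Fin n → ℕ) → ℂ) →ₗ[ℂ] ((Fin n → ℕ) → ℂ) :=
  ∑ k : Idx n, bar z k • ladder k

/-- The coefficient sequence of `(𝐳ᵀ 𝔞)^m |k⟩`. -/
def fieldPowFun {n : ℕ} (z : Fin n → ℂ) (m : ℕ) (k : Fin n → ℕ) : (Fin n → ℕ) → ℂ :=
  (field z ^ m) (Pi.single k 1)

theorem degree_of_fieldPowFun_ne_zero {n : ℕ} (z : Fin n → ℂ) (k : Fin n → ℕ) (m : ℕ) :
    ∀ l, fieldPowFun z m k l ≠ 0 → ∑ j, l j ≤ ∑ j, k j + m := by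
  induction m with
  | zero =>
    intro l hl
    have : l = k := by
      by_contra h
      exact hl (by simp [fieldPowFun, Pi.single_eq_of_ne h])
    simp [this]
  | succ m ih =>
    intro l hl
    by_contra hd
    push Not at hd
    apply hl
    have key : ∀ i, ladder i (fieldPowFun z m k) l = 0 := by
      rintro (j | j)
      · have h0 : fieldPowFun z m k (l + Pi.single j 1) = 0 := by
          by_contra h
          have := ih _ h
          simp only [Pi.add_apply, Finset.sum_add_distrib] at this
          omega
        simp [ladder, annihilate, h0]
      · rcases Nat.eq_zero_or_pos (l j) with hj | hj
        · simp [ladder, create, hj]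
        · have h0 : fieldPowFun z m k (l - Pi.single j 1) = 0 := by
            by_contra h
            have h1 := ih _ h
            have h2 : l = (l - Pi.single j 1) + Pi.single j 1 := by
              ext i
              by_cases hi : i = j
              · subst hi; simp; omega
              · simp [hi]
            have h3 : ∑ i, l i = ∑ i, (l - Pi.single j 1 : Fin n → ℕ) i + 1 := by
              conv_lhs => rw [h2]
              simp only [Pi.add_apply, Finset.sum_add_distrib]
              simp
            omega
          simp [ladder, create, h0]
    have h1 : fieldPowFun z (m + 1) k = field z (fieldPowFun z m k) := by
      simp [fieldPowFun, pow_succ']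
    rw [h1]
    simp [field, LinearMap.sum_apply, key]

theorem finite_degree_le {n : ℕ} (M : ℕ) : {l : Fin n → ℕ | ∑ j, l j ≤ M}.Finite :=
  (Set.finite_Iic (fun _ : Fin n => M)).subset fun l hl j =>
    (Finset.single_le_sum (f := l) (fun _ _ => Nat.zero_le _) (Finset.mem_univ j)).trans hl

theorem memℓp_of_degree_le {n : ℕ} {ψ : (Fin n → ℕ) → ℂ} {M : ℕ}
    (h : ∀ l, ψ l ≠ 0 → ∑ j, l j ≤ M) : Memℓp ψ 2 :=
  Memℓp.of_exponent_ge (memℓp_zero ((finite_degree_le M).subset h)) (by simp)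

/-- The vector `(𝐳ᵀ 𝔞)^m |k⟩`. -/
def fieldPow {n : ℕ} (z : Fin n → ℂ) (m : ℕ) (k : Fin n → ℕ) : Fock n :=
  ⟨fieldPowFun z m k, memℓp_of_degree_le (degree_of_fieldPowFun_ne_zero z k m)⟩

/-- The `m`-th term of the exponential series of `i 𝐳ᵀ 𝔞` at `|k⟩`. -/
def expTerm {n : ℕ} (z : Fin n → ℂ) (k : Fin n → ℕ) (m : ℕ) : Fock n :=
  (Complex.I ^ m / (m.factorial : ℂ)) • fieldPow z m k

theorem norm_le_of_shift {n : ℕ} {f g : Fock n} {B : ℝ} (hB : 0 ≤ B)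
    (σ : (Fin n → ℕ) → (Fin n → ℕ)) (hσ : Set.InjOn σ {l | g l ≠ 0})
    (h : ∀ l, g l ≠ 0 → ‖g l‖ ^ 2 ≤ B * ‖f (σ l)‖ ^ 2) : ‖g‖ ≤ Real.sqrt B * ‖f‖ := by
  classical
  have two : (2 : ENNReal).toReal = ((2 : ℕ) : ℝ) := by simp
  refine lp.norm_le_of_forall_sum_le (by simp) (by positivity) fun s => ?_
  simp only [two, Real.rpow_natCast]
  rw [mul_pow, Real.sq_sqrt hB]
  have h1 : ∑ l ∈ s, ‖g l‖ ^ 2 = ∑ l ∈ s with g l ≠ 0, ‖g l‖ ^ 2 := by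
    rw [Finset.sum_filter]
    refine Finset.sum_congr rfl fun l _ => ?_
    by_cases hl : g l = 0 <;> simp [hl]
  have h2 : ∑ l ∈ s with g l ≠ 0, ‖f (σ l)‖ ^ 2 =
      ∑ l ∈ (s.filter fun l => g l ≠ 0).image σ, ‖f l‖ ^ 2 := by
    rw [Finset.sum_image]
    intro a ha b hb hab
    exact hσ (by simpa using (Finset.mem_filter.1 ha).2)
      (by simpa using (Finset.mem_filter.1 hb).2) hab
  have h3 := lp.sum_rpow_le_norm_rpow (p := 2) (by simp) f
    ((s.filter fun l => g l ≠ 0).image σ)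
  simp only [two, Real.rpow_natCast] at h3
  calc ∑ l ∈ s, ‖g l‖ ^ 2 = ∑ l ∈ s with g l ≠ 0, ‖g l‖ ^ 2 := h1
    _ ≤ ∑ l ∈ s with g l ≠ 0, B * ‖f (σ l)‖ ^ 2 :=
        Finset.sum_le_sum fun l hl => h l (Finset.mem_filter.1 hl).2
    _ = B * ∑ l ∈ (s.filter fun l => g l ≠ 0).image σ, ‖f l‖ ^ 2 := by
        rw [← Finset.mul_sum, h2]
    _ ≤ B * ‖f‖ ^ 2 := by gcongr

theorem le_sum_coord {n : ℕ} (l : Fin n → ℕ) (j : Fin n) : l j ≤ ∑ i, l i :=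
  Finset.single_le_sum (f := l) (fun _ _ => Nat.zero_le _) (Finset.mem_univ j)

theorem norm_ladder_le {n : ℕ} (i : Idx n) {f g : Fock n} {M : ℕ}
    (hg : (g : (Fin n → ℕ) → ℂ) = ladder i f) (hf : ∀ l, f l ≠ 0 → ∑ j, l j ≤ M) :
    ‖g‖ ≤ Real.sqrt (M + 1) * ‖f‖ := by
  rcases i with j | j
  · have hgl : ∀ l, g l = (Real.sqrt (l j + 1) : ℂ) * f (l + Pi.single j 1) := fun l => by
      rw [hg]; rfl
    refine norm_le_of_shift (by positivity) (fun l => l + Pi.single j 1)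
      (fun a _ b _ hab => add_right_cancel hab) fun l hl => ?_
    have hfl : f (l + Pi.single j 1) ≠ 0 := fun h => hl (by rw [hgl, h, mul_zero])
    have h1 := (le_sum_coord _ j).trans (hf _ hfl)
    simp only [Pi.add_apply, Pi.single_eq_same] at h1
    have h2 : ((l j : ℝ) + 1) ≤ M := by exact_mod_cast h1
    rw [hgl, norm_mul, mul_pow, Complex.norm_real, Real.norm_eq_abs, sq_abs,
      Real.sq_sqrt (by positivity)]
    gcongr
    linarith
  · have hgl : ∀ l, g l = (Real.sqrt (l j) : ℂ) * f (l - Pi.single j 1) := fun l => by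
      rw [hg]; rfl
    have hpos : ∀ l, g l ≠ 0 → l - Pi.single j 1 + Pi.single j 1 = l := fun l hl => by
      have : l j ≠ 0 := fun h => hl (by rw [hgl, h]; simp)
      ext i
      by_cases hi : i = j
      · subst hi; simp; omega
      · simp [hi]
    refine norm_le_of_shift (by positivity) (fun l => l - Pi.single j 1)
      (fun a ha b hb hab => ?_) fun l hl => ?_
    · rw [← hpos a ha, ← hpos b hb]
      exact congrArg (· + Pi.single j 1) hab
    · have hfl : f (l - Pi.single j 1) ≠ 0 := fun h => hl (by rw [hgl, h, mul_zero])
      have h1 := (le_sum_coord _ j).trans (hf _ hfl)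
      have h2 : (l j : ℝ) ≤ M + 1 := by
        simp only [Pi.sub_apply, Pi.single_eq_same] at h1
        have : l j ≤ M + 1 := by omega
        exact_mod_cast this
      rw [hgl, norm_mul, mul_pow, Complex.norm_real, Real.norm_eq_abs, sq_abs,
        Real.sq_sqrt (by positivity)]
      gcongr

theorem inner_ladder {n : ℕ} (j : Fin n) {f f' g g' : Fock n}
    (hf : (f' : (Fin n → ℕ) → ℂ) = annihilate j f) (hg : (g' : (Fin n → ℕ) → ℂ) = create j g) :
    ⟪f', g⟫_ℂ = ⟪f, g'⟫_ℂ := by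
  rw [lp.inner_eq_tsum, lp.inner_eq_tsum]
  have hinj : Function.Injective fun l : Fin n → ℕ => l + Pi.single j 1 :=
    fun a b hab => add_right_cancel hab
  rw [← hinj.tsum_eq (f := fun l => ⟪f l, g' l⟫_ℂ)]
  · refine tsum_congr fun l => ?_
    rw [hf, hg]
    simp [annihilate, create]
    ring
  · intro l hl
    have : l j ≠ 0 := fun h => hl (by
      show ⟪f l, g' l⟫_ℂ = 0
      rw [hg]; simp [create, h])
    refine ⟨l - Pi.single j 1, ?_⟩
    ext i
    by_cases hi : i = j
    · subst hi; simp; omega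
    · simp [hi]

theorem exists_fieldPow_succ {n : ℕ} (z : Fin n → ℂ) (m : ℕ) (k : Fin n → ℕ) :
    ∃ L : Idx n → Fock n, (∀ i, (L i : (Fin n → ℕ) → ℂ) = ladder i (fieldPow z m k)) ∧
      fieldPow z (m + 1) k = ∑ i, bar z i • L i := by
  have hmem : ∀ i, Memℓp (ladder i (fieldPowFun z m k)) 2 := by
    intro i
    refine memℓp_of_degree_le (M := ∑ j, k j + m + 1) fun l hl => ?_
    have hd := degree_of_fieldPowFun_ne_zero z k m
    rcases i with j | j
    · have h0 : fieldPowFun z m k (l + Pi.single j 1) ≠ 0 := fun h => hl (by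
        simp [ladder, annihilate, h])
      have := hd _ h0
      simp only [Pi.add_apply, Finset.sum_add_distrib] at this
      omega
    · have h0 : fieldPowFun z m k (l - Pi.single j 1) ≠ 0 := fun h => hl (by
        simp [ladder, create, h])
      have h1 := hd _ h0
      have h2 : ∑ i, l i ≤ ∑ i, (l - Pi.single j 1 : Fin n → ℕ) i + 1 := by
        calc ∑ i, l i ≤ ∑ i, ((l - Pi.single j 1 : Fin n → ℕ) i + (Pi.single j 1 : Fin n → ℕ) i) := by
              refine Finset.sum_le_sum fun i _ => ?_
              simp only [Pi.sub_apply]; omega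
          _ = _ := by rw [Finset.sum_add_distrib]; simp
      omega
  refine ⟨fun i => ⟨_, hmem i⟩, fun i => rfl, ?_⟩
  ext l
  have h1 : fieldPowFun z (m + 1) k = field z (fieldPowFun z m k) := by
    simp [fieldPowFun, pow_succ']
  rw [lp.coeFn_sum]
  show fieldPowFun z (m + 1) k l = _
  rw [h1]
  simp [field, LinearMap.sum_apply, Finset.sum_apply]

theorem norm_fieldPow_succ_le {n : ℕ} (z : Fin n → ℂ) (m : ℕ) (k : Fin n → ℕ) :
    ‖fieldPow z (m + 1) k‖ ≤
      (∑ i, ‖bar z i‖) * Real.sqrt ((∑ j, k j + m : ℕ) + 1) * ‖fieldPow z m k‖ := by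
  obtain ⟨L, hL, h⟩ := exists_fieldPow_succ z m k
  rw [h, mul_assoc, Finset.sum_mul]
  refine (norm_sum_le _ _).trans (Finset.sum_le_sum fun i _ => ?_)
  rw [norm_smul]
  gcongr
  exact norm_ladder_le i (hL i) (degree_of_fieldPowFun_ne_zero z k m)

theorem summable_norm_expTerm {n : ℕ} (z : Fin n → ℂ) (k : Fin n → ℕ) :
    Summable fun m => ‖expTerm z k m‖ := by
  set c := ∑ i, ‖bar z i‖ with hc
  set K := ∑ j, k j with hK
  have hc0 : 0 ≤ c := Finset.sum_nonneg fun _ _ => norm_nonneg _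
  have hlim : Filter.Tendsto (fun m : ℕ => c * Real.sqrt ((K + m : ℕ) + 1) / (m + 1 : ℝ))
      Filter.atTop (nhds 0) := by
    have h1 : Filter.Tendsto (fun m : ℕ => c * Real.sqrt (K + 1) / Real.sqrt ((m : ℝ) + 1))
        Filter.atTop (nhds 0) := by
      refine Filter.Tendsto.div_atTop tendsto_const_nhds ?_
      exact Real.tendsto_sqrt_atTop.comp
        (Filter.tendsto_atTop_add_const_right _ 1 tendsto_natCast_atTop_atTop)
    refine squeeze_zero (fun m => by positivity) (fun m => ?_) h1
    rw [div_le_div_iff₀ (by positivity) (by positivity), mul_assoc, mul_assoc]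
    have h2 : Real.sqrt ((K + m : ℕ) + 1) ≤ Real.sqrt (K + 1) * Real.sqrt (m + 1) := by
      rw [← Real.sqrt_mul (by positivity)]
      apply Real.sqrt_le_sqrt
      push_cast
      nlinarith [(Nat.cast_nonneg K : (0 : ℝ) ≤ K), (Nat.cast_nonneg m : (0 : ℝ) ≤ m)]
    refine mul_le_mul_of_nonneg_left ?_ hc0
    calc Real.sqrt ((K + m : ℕ) + 1) * Real.sqrt (m + 1)
        ≤ Real.sqrt (K + 1) * Real.sqrt (m + 1) * Real.sqrt (m + 1) := by gcongr
      _ = Real.sqrt (K + 1) * (m + 1) := by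
        rw [mul_assoc, Real.mul_self_sqrt (by positivity)]
  refine summable_of_ratio_norm_eventually_le (r := 1 / 2) (by norm_num) ?_
  filter_upwards [hlim.eventually (gt_mem_nhds (show (0 : ℝ) < 1 / 2 by norm_num))] with m hm
  rw [norm_norm, norm_norm, expTerm, expTerm, norm_smul, norm_smul]
  simp only [norm_div, norm_pow, Complex.norm_I, one_pow, Complex.norm_natCast]
  have h := norm_fieldPow_succ_le z m k
  calc 1 / ((m + 1).factorial : ℝ) * ‖fieldPow z (m + 1) k‖
      ≤ 1 / ((m + 1).factorial : ℝ) *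
        (c * Real.sqrt ((K + m : ℕ) + 1) * ‖fieldPow z m k‖) := by gcongr
    _ = (c * Real.sqrt ((K + m : ℕ) + 1) / (m + 1 : ℝ)) *
        (1 / (m.factorial : ℝ) * ‖fieldPow z m k‖) := by
        rw [Nat.factorial_succ]; push_cast; field_simp
    _ ≤ 1 / 2 * (1 / (m.factorial : ℝ) * ‖fieldPow z m k‖) := by gcongr

theorem inner_fieldPow_succ {n : ℕ} (z : Fin n → ℂ) (m p : ℕ) (k l : Fin n → ℕ) :
    ⟪fieldPow z (m + 1) k, fieldPow z p l⟫_ℂ = ⟪fieldPow z m k, fieldPow z (p + 1) l⟫_ℂ := by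
  obtain ⟨L, hL, h⟩ := exists_fieldPow_succ z m k
  obtain ⟨L', hL', h'⟩ := exists_fieldPow_succ z p l
  rw [h, h', sum_inner, inner_sum, Fintype.sum_sum_type, Fintype.sum_sum_type, add_comm]
  congr 1
  · refine Finset.sum_congr rfl fun j _ => ?_
    rw [inner_smul_left, inner_smul_right, ← inner_conj_symm (L (Sum.inr j)),
      ← inner_ladder j (hL' (Sum.inl j)) (hL (Sum.inr j)), inner_conj_symm]
    simp [bar]
  · refine Finset.sum_congr rfl fun j _ => ?_
    rw [inner_smul_left, inner_smul_right, inner_ladder j (hL (Sum.inl j)) (hL' (Sum.inr j))]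
    simp [bar]

theorem inner_fieldPow {n : ℕ} (z : Fin n → ℂ) (k l : Fin n → ℕ) (m : ℕ) : ∀ p,
    ⟪fieldPow z m k, fieldPow z p l⟫_ℂ = ⟪fieldPow z 0 k, fieldPow z (m + p) l⟫_ℂ := by
  induction m with
  | zero => intro p; rw [zero_add]
  | succ m ih =>
    intro p
    rw [inner_fieldPow_succ, ih, add_right_comm, add_assoc]

/-- The image of `|k⟩` under `exp (i 𝐳ᵀ 𝔞) = ∑ₘ (i 𝐳ᵀ 𝔞)^m / m!`. -/
def expVec {n : ℕ} (z : Fin n → ℂ) (k : Fin n → ℕ) : Fock n := ∑' m, expTerm z k m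

theorem hasSum_expVec {n : ℕ} (z : Fin n → ℂ) (k : Fin n → ℕ) :
    HasSum (expTerm z k) (expVec z k) :=
  (summable_norm_expTerm z k).of_norm.hasSum

theorem fieldPow_zero {n : ℕ} (z : Fin n → ℂ) (k : Fin n → ℕ) : fieldPow z 0 k = ket k := by
  ext l
  show fieldPowFun z 0 k l = _
  by_cases h : l = k
  · subst h; simp [fieldPowFun, ket]
  · simp [fieldPowFun, ket, h, lp.single_apply]

theorem inner_expVec {n : ℕ} (z : Fin n → ℂ) (k l : Fin n → ℕ) :
    ⟪expVec z k, expVec z l⟫_ℂ = ⟪ket k, ket l⟫_ℂ := by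
  set F : ℕ × ℕ → ℂ := fun q => ⟪expTerm z k q.1, expTerm z l q.2⟫_ℂ with hF
  have hs : Summable F := by
    refine Summable.of_norm_bounded
      ((summable_norm_expTerm z k).mul_of_nonneg (summable_norm_expTerm z l)
        (fun _ => norm_nonneg _) (fun _ => norm_nonneg _)) fun q => norm_inner_le_norm _ _
  have h1 : HasSum F ⟪expVec z k, expVec z l⟫_ℂ := by
    have hin : ∀ m, HasSum (fun p => F (m, p)) ⟪expTerm z k m, expVec z l⟫_ℂ := fun m =>
      (hasSum_expVec z l).mapL (innerSL ℂ (expTerm z k m))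
    have hout : HasSum (fun m => ⟪expTerm z k m, expVec z l⟫_ℂ) ⟪expVec z k, expVec z l⟫_ℂ := by
      have := ((hasSum_expVec z k).mapL (innerSL ℂ (expVec z l))).star
      simpa [inner_conj_symm] using this
    have := hs.hasSum.prod_fiberwise hin
    rw [← this.unique hout]
    exact hs.hasSum
  have h2 := (Finset.HasAntidiagonal.sigmaAntidiagonalEquivProd (A := ℕ)).hasSum_iff.2 h1
  have h3 := h2.sigma fun N => hasSum_fintype _
  refine h3.unique ?_
  have hz : ∀ N : ℕ, (∑ c : Finset.HasAntidiagonal.antidiagonal N,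
      (F ∘ Finset.HasAntidiagonal.sigmaAntidiagonalEquivProd) ⟨N, c⟩) =
      if N = 0 then ⟪ket k, ket l⟫_ℂ else 0 := by
    intro N
    have e : (∑ c : Finset.HasAntidiagonal.antidiagonal N,
        (F ∘ Finset.HasAntidiagonal.sigmaAntidiagonalEquivProd) ⟨N, c⟩) =
        ∑ c ∈ Finset.HasAntidiagonal.antidiagonal N, F c :=
      Finset.sum_coe_sort (Finset.HasAntidiagonal.antidiagonal N) F
    rw [e]
    have hterm : ∀ c ∈ Finset.HasAntidiagonal.antidiagonal N, F c =
        (1 / (N.factorial : ℂ) * ⟪fieldPow z 0 k, fieldPow z N l⟫_ℂ) *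
          (N.choose c.1 • ((-Complex.I) ^ c.1 * Complex.I ^ c.2)) := by
      rintro ⟨a, b⟩ hab
      rw [Finset.HasAntidiagonal.mem_antidiagonal] at hab
      subst hab
      simp only [hF, expTerm, inner_smul_left, inner_smul_right, inner_fieldPow z k l a b]
      have hf : ((a + b).factorial : ℂ) = (a + b).choose a * a.factorial * b.factorial := by
        rw [Nat.choose_symm_add]
        exact_mod_cast (Nat.add_choose_mul_factorial_mul_factorial a b).symm
      have h4 : ((a + b).choose a : ℂ) ≠ 0 := by
        exact_mod_cast (Nat.choose_pos (Nat.le_add_right a b)).ne'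
      have h5 : (a.factorial : ℂ) ≠ 0 := by exact_mod_cast a.factorial_ne_zero
      have h6 : (b.factorial : ℂ) ≠ 0 := by exact_mod_cast b.factorial_ne_zero
      rw [hf]
      simp only [map_div₀, map_pow, Complex.conj_I, Complex.conj_natCast, nsmul_eq_mul]
      field_simp
    rw [Finset.sum_congr rfl hterm, ← Finset.mul_sum,
      ← (Commute.all (-Complex.I) Complex.I).add_pow' N, neg_add_cancel]
    by_cases hN : N = 0
    · subst hN; simp [fieldPow_zero]
    · simp [hN]
  simp_rw [hz]
  exact hasSum_ite_eq 0 _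

theorem orthonormal_expVec {n : ℕ} (z : Fin n → ℂ) : Orthonormal ℂ (expVec z) := by
  classical
  rw [orthonormal_iff_ite]
  intro k l
  rw [inner_expVec]
  simp [ket, lp.inner_single_left, lp.single_apply, Pi.single_apply]

/-- The operator `exp (i 𝐳ᵀ 𝔞)`: the bounded (isometric) extension of the exponential series,
which converges on the number states. -/
def weyl {n : ℕ} (z : Fin n → ℂ) : Fock n →L[ℂ] Fock n :=
  (orthonormal_expVec z).orthogonalFamily.linearIsometry.toContinuousLinearMap

theorem hasSum_weyl_ket {n : ℕ} (z : Fin n → ℂ) (k : Fin n → ℕ) :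
    HasSum (fun m : ℕ => (Complex.I ^ m / (m.factorial : ℂ)) • fieldPow z m k)
      (weyl z (ket k)) := by
  have h : weyl z (ket k) = expVec z k := by
    have := (orthonormal_expVec z).orthogonalFamily.linearIsometry_apply_single (i := k) (1 : ℂ)
    exact this.trans (by simp)
  rw [h]
  exact hasSum_expVec z k

/-! ### Gaussian states -/

/-- The characteristic function `h(𝐳) = tr (exp (i 𝐳ᵀ 𝔞) ρ)`. -/
def charFun {n : ℕ} (ρ : Fock n →L[ℂ] Fock n) (z : Fin n → ℂ) : ℂ := trace (weyl z ∘L ρ)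

open scoped Matrix in
/-- `ρ` is a Gaussian state with mean `μ` and covariance matrix `C`:
`h(𝐳) = exp ((i 𝐳)ᵀ μ + ½ (i 𝐳)ᵀ C (i 𝐳))`. -/
structure IsGaussian {n : ℕ} (ρ : Fock n →L[ℂ] Fock n) (μ : Idx n → ℂ)
    (C : Matrix (Idx n) (Idx n) ℂ) : Prop where
  isDensityOperator : IsDensityOperator ρ
  isSymm : C.IsSymm
  charFun_eq : ∀ z : Fin n → ℂ, charFun ρ z =
    Complex.exp ((Complex.I • bar z) ⬝ᵥ μ +
      1 / 2 * ((Complex.I • bar z) ⬝ᵥ (C *ᵥ (Complex.I • bar z))))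

/-! ### Set-valued indices

A component of a tensor with factors numbered by `I ⊂ ℕ` is selected by a map `κ`, which gives the
label `κ j` in the `j`-th factor. -/

/-- The component `∏_{j ∈ I} 𝔞_{κ j}` of `𝔞_I`, the factors in ascending order of `j`. -/
def ladderSet {n : ℕ} (κ : ℕ → Idx n) (I : Finset ℕ) : Fock n →ₗ.[ℂ] Fock n :=
  ladderProd ((I.sort (· ≤ ·)).map κ)

/-- The component of `μ_I = ∏_{j ∈ I} μ_j`. -/
def vecSet {n : ℕ} (μ : Idx n → ℂ) (κ : ℕ → Idx n) (I : Finset ℕ) : ℂ := ∏ j ∈ I, μ (κ j)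

/-- The component of `D_p` for a pair `p = {i < j}`, that is, `D_{κ i, κ j}`. -/
def pairEntry {n : ℕ} (D : Matrix (Idx n) (Idx n) ℂ) (κ : ℕ → Idx n) (p : Finset ℕ) : ℂ :=
  ∏ q ∈ p ×ˢ p with q.1 < q.2, D (κ q.1) (κ q.2)

/-- The component of `D_I = ∑ D_{p₁} ⋯ D_{p_{|I|/2}}`, the sum over all partitions of `I` into
pairs (there are none if `|I|` is odd, and only the empty one if `I` is empty). -/
def pairingSum {n : ℕ} (D : Matrix (Idx n) (Idx n) ℂ) (κ : ℕ → Idx n) (I : Finset ℕ) : ℂ :=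
  ∑ P : Finpartition I with ∀ p ∈ P.parts, p.card = 2, ∏ p ∈ P.parts, pairEntry D κ p

end Fock

end

/-! Write `ρ = ∑ ⟨e_l, ·⟩ e_l` with `e_l = √ρ |l⟩`, a square summable family.

Analysis: along a ray, `s ↦ charFun ρ (s • z)` is the smooth curve `exp (a s + b s²)`. Let `W z =
weyl z`. The operators `((W(tz) - W(-tz)) / (2it))^m` tend entrywise to `field z ^ m` as `t → 0`.
Since `W(tz) - W(-tz)` is skew-adjoint, the squared Hilbert–Schmidt norm of these operators on the
family `e` is, up to sign, a difference quotient of order `2m` of the characteristic function, hence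
bounded. So the family `field z ^ m e_l` is square summable, convergence is weak, and the moment of
`field z ^ m` is `i^(-m)` times the `m`-th derivative of the curve at `0`
(`exists_moment_field_pow`).

Algebra: the operators `μ_k + X_k + ∑ D_kl ∂_l` on polynomials, with `D = C - ½ J`, obey the same
commutation relations as the ladder operators. The vacuum expectations of powers of their fields
satisfy the recursion of those derivatives (`iteratedDeriv_gaussCurve_eq_vacuum`). Any product of
operators with scalar commutators is a linear combination of powers of fields
(`list_prod_mem_span_pow`). Taken in the product of the two algebras, this gives one combination
valid for both, so every moment is a vacuum expectation (`IsGaussian.hasExpectation`).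

Combinatorics: moving the derivation of the leftmost factor to the right shows that vacuum
expectations obey the recursion of the sum over pairings (`vacuum_wickSet`). -/

noncomputable section

open scoped ComplexConjugate InnerProductSpace
open Filter Topology Asymptotics

/-! ### Products as linear combinations of powers of fields. -/

section PowerSpan

variable {R : Type*} [Ring R] [Algebra ℂ R]

/-- The expansion of `(X + t Y) ^ m` in powers of `t` up to first order, when the commutator of
`X` and `Y` is a scalar. -/
theorem exists_add_smul_pow_expansion {X Y : R} {c : ℂ}
    (h : X * Y = Y * X + algebraMap ℂ R c) (m : ℕ) :
    ∃ (d : ℕ → R) (b : Polynomial ℂ), d 0 = X ^ m ∧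
      d 1 = (m : ℂ) • (Y * X ^ (m - 1)) + Polynomial.aeval X b ∧
      ∀ t : ℂ, (X + t • Y) ^ m = ∑ i ∈ Finset.range (m + 1), t ^ i • d i := by
  induction m with
  | zero => exact ⟨fun i => if i = 0 then 1 else 0, 0, by simp, by simp, fun t => by simp⟩
  | succ m ih =>
    obtain ⟨d, b, h0, h1, hd⟩ := ih
    -- From `(X + tY)(X + tY)^m`; the guard `i ≤ m` discards values of `d` that the induction
    -- hypothesis does not control. Moving `Y` to the left of `X` in `X * (m Y X^(m-1))` leaves the
    -- scalar term `m c X^(m-1)`.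
    refine ⟨fun i => (if i ≤ m then X * d i else 0) + (if i = 0 then 0 else Y * d (i - 1)),
      if m = 0 then 0 else
        Polynomial.X * b + Polynomial.C ((m : ℂ) * c) * Polynomial.X ^ (m - 1), ?_, ?_, ?_⟩
    · simp [h0, pow_succ']
    · rcases m with _ | m
      · simp [h0]
      · have h2 : X * (Y * X ^ m) = Y * X ^ (m + 1) + c • X ^ m := by
          rw [← mul_assoc, h, add_mul, Algebra.algebraMap_eq_smul_one, smul_mul_assoc, one_mul,
            mul_assoc, ← pow_succ']
        simp only [le_add_iff_nonneg_left, zero_le, if_true, one_ne_zero, if_false,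
          Nat.add_sub_cancel, h1, h0, Nat.sub_self, Nat.succ_ne_zero, mul_add, mul_smul_comm, h2,
          map_add, map_mul, Polynomial.aeval_X, Polynomial.aeval_C, map_pow, smul_add, smul_smul,
          Algebra.algebraMap_eq_smul_one, smul_mul_assoc, one_mul]
        push_cast
        module
    · intro t
      rw [pow_succ', hd, add_mul, Finset.mul_sum, Finset.mul_sum]
      simp only [smul_add, Finset.sum_add_distrib]
      congr 1
      · rw [Finset.sum_range_succ _ (m + 1)]
        simp only [show ¬ (m + 1 ≤ m) by omega, if_false, smul_zero, add_zero]
        refine Finset.sum_congr rfl fun i hi => ?_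
        rw [if_pos (by simpa [Nat.lt_succ_iff] using hi), mul_smul_comm]
      · rw [Finset.sum_range_succ' _ (m + 1)]
        simp only [Nat.succ_ne_zero, if_false, if_true, smul_zero, add_zero, Nat.add_sub_cancel]
        refine Finset.sum_congr rfl fun i hi => ?_
        rw [smul_mul_assoc, mul_smul_comm, smul_smul, pow_succ']

/-- The coefficients of a polynomial curve lie in any subspace that contains its values at real
arguments. -/
theorem coeff_mem_of_forall_sum_mem {M : Type*} [AddCommGroup M] [Module ℂ M]
    (S : Submodule ℂ M) (N : ℕ) (d : ℕ → M)
    (h : ∀ t : ℝ, ∑ i ∈ Finset.range N, (t : ℂ) ^ i • d i ∈ S) {i : ℕ} (hi : i < N) : d i ∈ S := by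
  by_contra hd
  -- A functional that vanishes on `S` but not at `d i` turns the curve into a scalar polynomial
  -- with infinitely many roots.
  obtain ⟨f, hf, hS⟩ := Submodule.exists_le_ker_of_notMem hd
  set p : Polynomial ℂ := ∑ i ∈ Finset.range N, Polynomial.monomial i (f (d i)) with hp
  have hp0 : p = 0 := by
    refine Polynomial.eq_zero_of_infinite_isRoot p
      ((Set.infinite_range_of_injective Complex.ofReal_injective).mono ?_)
    rintro _ ⟨t, rfl⟩
    have := hS (h t)
    rw [LinearMap.mem_ker, map_sum] at this
    simpa [hp, Polynomial.IsRoot, Polynomial.eval_finsetSum, mul_comm] using this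
  apply hf
  have := congrArg (fun q => Polynomial.coeff q i) hp0
  simpa [hp, Polynomial.finsetSum_coeff, Polynomial.coeff_monomial, hi] using this

variable {V : Type*} [AddCommGroup V] [Module ℝ V]

/-- If the commutators of `L v` and `L w` are scalars, the span of the powers of the `L v` is
invariant under multiplication by all `L w`. -/
theorem mul_mem_span_pow {L : V → R}
    (hL : ∀ (v w : V) (t : ℝ), L (v + t • w) = L v + (t : ℂ) • L w)
    (hc : ∀ v w, ∃ c : ℂ, L v * L w = L w * L v + algebraMap ℂ R c)
    (w : V) {x : R} (hx : x ∈ Submodule.span ℂ {x | ∃ v m, x = L v ^ m}) :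
    L w * x ∈ Submodule.span ℂ {x | ∃ v m, x = L v ^ m} := by
  set S := Submodule.span ℂ {x | ∃ v m, x = L v ^ m} with hS
  have hpow : ∀ v m, L v ^ m ∈ S := fun v m => Submodule.subset_span ⟨v, m, rfl⟩
  suffices S ≤ S.comap (LinearMap.mulLeft ℂ (L w)) from this hx
  rw [hS, Submodule.span_le, ← hS]
  rintro _ ⟨v, m, rfl⟩
  obtain ⟨c, hcvw⟩ := hc v w
  -- The coefficient of `t` in `L (v + t w) ^ (m + 1)` is `(m + 1) L w (L v)^m` plus a polynomial in
  -- `L v`. Only real `t` are available, as `L` is merely real-linear.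
  obtain ⟨d, b, -, h1, hd⟩ := exists_add_smul_pow_expansion hcvw (m + 1)
  have hd1 : d 1 ∈ S := coeff_mem_of_forall_sum_mem S (m + 1 + 1) d
    (fun t => by rw [← hd, ← hL]; exact hpow _ _) (by omega)
  have hb : Polynomial.aeval (L v) b ∈ S := by
    rw [Polynomial.aeval_eq_sum_range]
    exact S.sum_mem fun i _ => S.smul_mem _ (hpow _ _)
  have h2 : ((m : ℂ) + 1) • (L w * L v ^ m) ∈ S := by
    have := S.sub_mem hd1 hb
    rw [h1, add_sub_cancel_right] at this
    simpa using this
  have h3 := S.smul_mem ((m : ℂ) + 1)⁻¹ h2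
  rwa [smul_smul, inv_mul_cancel₀ (by exact_mod_cast m.succ_ne_zero), one_smul] at h3

end PowerSpan

/-! ### Central differences and derivatives. -/

section CentralDifference

/-- The iterated central difference `∑ₖ (-1)^(m-k) (m choose k) f((2k - m)t)`. -/
def centralDiff {E : Type*} [AddCommGroup E] [Module ℝ E] (m : ℕ) (f : ℝ → E) (t : ℝ) : E :=
  ∑ k ∈ Finset.range (m + 1), ((-1 : ℝ) ^ (m - k) * (m.choose k : ℝ)) • f ((2 * k - m) * t)

theorem centralDiff_add {E : Type*} [AddCommGroup E] [Module ℝ E] (m : ℕ) (f g : ℝ → E) (t : ℝ) :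
    centralDiff m (fun s => f s + g s) t = centralDiff m f t + centralDiff m g t := by
  simp [centralDiff, Finset.sum_add_distrib]

/-- After scaling by `2` this is the `m`-th forward difference of `r ^ j` at `-m/2`, which vanishes
below degree `m`. -/
theorem sum_choose_mul_pow_central (m j : ℕ) (hj : j ≤ m) :
    ∑ k ∈ Finset.range (m + 1), ((-1 : ℝ) ^ (m - k) * (m.choose k : ℝ)) * (2 * k - m : ℝ) ^ j =
      if j = m then 2 ^ m * (m.factorial : ℝ) else 0 := by
  have h1 : ∑ k ∈ Finset.range (m + 1),
      ((-1 : ℝ) ^ (m - k) * (m.choose k : ℝ)) * (2 * k - m : ℝ) ^ j =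
      2 ^ j * (fwdDiff 1)^[m] (fun r : ℝ => r ^ j) (-(m / 2 : ℝ)) := by
    rw [fwdDiff_iter_eq_sum_shift, Finset.mul_sum]
    refine Finset.sum_congr rfl fun k _ => ?_
    rw [show (2 * k - m : ℝ) = 2 * (-(m / 2 : ℝ) + k • 1) by simp; ring, mul_pow]
    simp only [zsmul_eq_mul]
    push_cast
    ring
  rw [h1]
  split_ifs with h
  · subst h
    rw [fwdDiff_iter_eq_factorial]; simp
  · rw [fwdDiff_iter_pow_eq_zero_of_lt (by omega)]; simp

/-- Only an expansion with remainder `o(s^m)` at `0` is required, so the result serves both the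
exponential series on number states and the Taylor expansion of the characteristic function. -/
theorem tendsto_centralDiff {E : Type*} [NormedAddCommGroup E] [NormedSpace ℝ E] (m : ℕ)
    (f : ℝ → E) (c : ℕ → E)
    (hf : (fun s => f s - ∑ k ∈ Finset.range (m + 1), s ^ k • c k) =o[𝓝 0] fun s : ℝ => s ^ m) :
    Tendsto (fun t : ℝ => ((2 * t) ^ m)⁻¹ • centralDiff m f t) (𝓝[≠] 0)
      (𝓝 ((m.factorial : ℝ) • c m)) := by
  set r : ℝ → E := fun s => f s - ∑ k ∈ Finset.range (m + 1), s ^ k • c k with hr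
  have hsplit : ∀ t, centralDiff m f t =
      (2 ^ m * (m.factorial : ℝ) * t ^ m) • c m + centralDiff m r t := by
    intro t
    have h1 : centralDiff m f t =
        centralDiff m (fun s => (∑ k ∈ Finset.range (m + 1), s ^ k • c k) + r s) t := by
      congr 1; ext s; simp [hr]
    rw [h1, centralDiff_add]
    congr 1
    simp only [centralDiff, Finset.smul_sum]
    rw [Finset.sum_comm, Finset.sum_eq_single m]
    · rw [← sum_choose_mul_pow_central m m le_rfl |>.trans (if_pos rfl), Finset.sum_mul,
        Finset.sum_smul]
      refine Finset.sum_congr rfl fun k _ => ?_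
      rw [smul_smul, mul_pow]; ring_nf
    · intro j hj hjm
      have h2 := (sum_choose_mul_pow_central m j (by simpa [Nat.lt_succ_iff] using hj)).trans
        (if_neg hjm)
      calc _ = ((∑ k ∈ Finset.range (m + 1),
          ((-1 : ℝ) ^ (m - k) * (m.choose k : ℝ)) * (2 * k - m : ℝ) ^ j) * t ^ j) • c j := by
            rw [Finset.sum_mul, Finset.sum_smul]
            refine Finset.sum_congr rfl fun k _ => ?_
            rw [smul_smul, mul_pow]; ring_nf
        _ = 0 := by rw [h2]; simp
    · simp
  have hsmall : (fun t => centralDiff m r t) =o[𝓝 0] fun t : ℝ => t ^ m := by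
    refine IsLittleO.fun_sum fun k _ => IsLittleO.const_smul_left ?_ _
    have h1 : Tendsto (fun t : ℝ => (2 * k - m : ℝ) * t) (𝓝 0) (𝓝 0) := by
      have : Continuous fun t : ℝ => (2 * k - m : ℝ) * t := by fun_prop
      simpa using this.tendsto 0
    refine (hf.comp_tendsto h1).trans_isBigO ?_
    simp only [Function.comp_def, mul_pow]
    exact (isBigO_refl _ _).const_mul_left _
  have h3 : Tendsto (fun t : ℝ => ((2 * t) ^ m)⁻¹ • centralDiff m r t) (𝓝[≠] 0) (𝓝 0) := by
    have h4 : (fun t => centralDiff m r t) =o[𝓝[≠] 0] fun t : ℝ => (2 * t) ^ m := by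
      refine (hsmall.mono nhdsWithin_le_nhds).trans_isBigO ?_
      simp only [mul_pow]
      exact (isBigO_refl _ _).const_mul_right (by positivity)
    rw [tendsto_zero_iff_norm_tendsto_zero]
    have := h4.norm_norm.tendsto_div_nhds_zero
    refine this.congr fun t => ?_
    rw [norm_smul, norm_inv, div_eq_inv_mul]
  have h5 := (tendsto_const_nhds (x := (m.factorial : ℝ) • c m)).add h3
  rw [add_zero] at h5
  refine h5.congr' ?_
  filter_upwards [self_mem_nhdsWithin] with t ht
  rw [hsplit, smul_add, smul_smul]
  congr 2
  have : t ≠ 0 := ht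
  rw [mul_pow]
  field_simp

end CentralDifference

namespace Fock

/-! ### The polynomial model of the commutation relations. -/

section Wick

variable {σ : Type*}

/-- The derivation `∑ₗ D_{kl} ∂ₗ` of the polynomial ring. -/
def contraction (D : Matrix σ σ ℂ) (k : σ) :
    Derivation ℂ (MvPolynomial σ ℂ) (MvPolynomial σ ℂ) :=
  MvPolynomial.mkDerivation ℂ fun l => MvPolynomial.C (D k l)

/-- The operator `μ_k + X_k + ∑ₗ D_{kl} ∂ₗ` on polynomials. -/
def wickOp (μ : σ → ℂ) (D : Matrix σ σ ℂ) (k : σ) : Module.End ℂ (MvPolynomial σ ℂ) :=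
  algebraMap ℂ _ (μ k) + LinearMap.mulLeft ℂ (MvPolynomial.X k) + (contraction D k).toLinearMap

theorem wickOp_apply (μ : σ → ℂ) (D : Matrix σ σ ℂ) (k : σ) (p : MvPolynomial σ ℂ) :
    wickOp μ D k p = μ k • p + MvPolynomial.X k * p + contraction D k p := by
  simp [wickOp, Module.algebraMap_end_apply]

theorem contraction_X (D : Matrix σ σ ℂ) (k l : σ) :
    contraction D k (MvPolynomial.X l) = MvPolynomial.C (D k l) :=
  MvPolynomial.mkDerivation_X _ _ _

/-- The commutator is again a derivation, and it kills the variables because both contractions send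
them to constants. -/
theorem contraction_comm (D : Matrix σ σ ℂ) (k l : σ) (p : MvPolynomial σ ℂ) :
    contraction D k (contraction D l p) = contraction D l (contraction D k p) := by
  have h : ⁅contraction D k, contraction D l⁆ = 0 := by
    refine MvPolynomial.derivation_ext fun i => ?_
    simp [Derivation.commutator_apply, contraction_X, MvPolynomial.derivation_C]
  have := DFunLike.congr_fun h p
  rwa [Derivation.commutator_apply, Derivation.zero_apply, sub_eq_zero] at this

theorem wickOp_commutator (μ : σ → ℂ) (D : Matrix σ σ ℂ) (k l : σ) :
    wickOp μ D k * wickOp μ D l = wickOp μ D l * wickOp μ D k +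
      algebraMap ℂ _ (D k l - D l k) := by
  refine LinearMap.ext fun p => ?_
  simp only [Module.End.mul_apply, LinearMap.add_apply, Module.algebraMap_end_apply, wickOp_apply,
    map_add, Derivation.leibniz, contraction_X, contraction_comm D k l, Derivation.map_smul,
    smul_eq_mul]
  simp only [MvPolynomial.smul_eq_C_mul, map_sub]
  ring

/-- The vacuum expectation of an operator on polynomials: the constant coefficient of its value
at `1`. -/
def vacuum : Module.End ℂ (MvPolynomial σ ℂ) →ₗ[ℂ] ℂ :=
  (MvPolynomial.aeval (fun _ : σ => (0 : ℂ))).toLinearMap ∘ₗ LinearMap.applyₗ 1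

theorem vacuum_apply (B : Module.End ℂ (MvPolynomial σ ℂ)) :
    vacuum B = MvPolynomial.aeval (fun _ : σ => (0 : ℂ)) (B 1) := rfl

theorem vacuum_one : vacuum (1 : Module.End ℂ (MvPolynomial σ ℂ)) = 1 := by
  simp [vacuum_apply]

/-- With `V = v·μ + ξ + d`, where `ξ` is linear and `d ξ = β` is constant, one has `[d, V] = β`,
hence `d (V^m 1) = m β V^(m-1) 1`. The constant coefficient removes the contribution of `ξ`. -/
theorem vacuum_sum_wickOp_pow_succ [Fintype σ] (μ : σ → ℂ) (D : Matrix σ σ ℂ) (v : σ → ℂ) (m : ℕ) :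
    vacuum ((∑ k, v k • wickOp μ D k) ^ (m + 1)) =
      (v ⬝ᵥ μ) * vacuum ((∑ k, v k • wickOp μ D k) ^ m) +
      m * (v ⬝ᵥ D.mulVec v) * vacuum ((∑ k, v k • wickOp μ D k) ^ (m - 1)) := by
  set V := ∑ k, v k • wickOp μ D k with hV
  set d : Derivation ℂ (MvPolynomial σ ℂ) (MvPolynomial σ ℂ) := ∑ k, v k • contraction D k with hd
  set ξ : MvPolynomial σ ℂ := ∑ k, v k • MvPolynomial.X k with hξ
  set β := v ⬝ᵥ D.mulVec v with hβ
  have hdapp : ∀ p, d p = ∑ k, v k • contraction D k p := fun p => by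
    rw [hd, ← Derivation.coeFnAddMonoidHom_apply, map_sum, Finset.sum_apply]; rfl
  have hVapp : ∀ p, V p = (v ⬝ᵥ μ) • p + ξ * p + d p := by
    intro p
    rw [hdapp, hV, LinearMap.sum_apply]
    simp only [LinearMap.smul_apply, wickOp_apply, smul_add, Finset.sum_add_distrib, hξ,
      Finset.sum_mul, smul_mul_assoc, dotProduct, Finset.sum_smul, smul_smul]
  have hdξ : d ξ = MvPolynomial.C β := by
    rw [hdapp, hξ, hβ]
    simp only [map_sum, Derivation.map_smul, contraction_X, dotProduct, Matrix.mulVec]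
    simp only [MvPolynomial.smul_eq_C_mul, Finset.mul_sum, map_sum, map_mul]
    exact Finset.sum_congr rfl fun k _ => Finset.sum_congr rfl fun l _ => by ring
  have hdV : ∀ p, d (V p) = V (d p) + β • p := by
    intro p
    simp only [hVapp, map_add, Derivation.map_smul, Derivation.leibniz, hdξ, smul_eq_mul]
    simp only [MvPolynomial.smul_eq_C_mul]
    ring
  have hpow : ∀ m : ℕ, d ((V ^ m) 1) = ((m : ℂ) * β) • (V ^ (m - 1)) 1 := by
    intro m
    induction m with
    | zero => simp
    | succ m ih =>
      rw [pow_succ', Module.End.mul_apply, hdV, ih, map_smul]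
      have h1 : ((m : ℂ) * β) • V ((V ^ (m - 1)) 1) = ((m : ℂ) * β) • (V ^ m) 1 := by
        rcases m with _ | m
        · simp
        · rw [Nat.add_sub_cancel, pow_succ', Module.End.mul_apply]
      rw [h1, ← add_smul, Nat.add_sub_cancel]
      push_cast
      ring_nf
  rw [vacuum_apply, pow_succ', Module.End.mul_apply, hVapp, hpow, vacuum_apply, vacuum_apply]
  simp [hξ]

/-- The product of the operators `wickOp μ D (κ j)`, `j ∈ I`, in ascending order of `j`. -/
def wickSet (μ : σ → ℂ) (D : Matrix σ σ ℂ) (κ : ℕ → σ) (I : Finset ℕ) :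
    Module.End ℂ (MvPolynomial σ ℂ) :=
  (((I.sort (· ≤ ·)).map κ).map (wickOp μ D)).prod

theorem wickSet_insert (μ : σ → ℂ) (D : Matrix σ σ ℂ) (κ : ℕ → σ) {a : ℕ} {S : Finset ℕ}
    (h : ∀ b ∈ S, a < b) :
    wickSet μ D κ (insert a S) = wickOp μ D (κ a) * wickSet μ D κ S := by
  rw [wickSet, Finset.sort_insert _ (fun b hb => (h b hb).le) fun ha => (h a ha).false]
  simp [wickSet]

/-- The contraction kills `1` and commutes with each Wick operator up to a scalar, so it acts by
deleting one factor at a time. -/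
theorem contraction_wickSet (μ : σ → ℂ) (D : Matrix σ σ ℂ) (κ : ℕ → σ) (k : σ) (S : Finset ℕ) :
    contraction D k (wickSet μ D κ S 1) = ∑ j ∈ S, D k (κ j) • wickSet μ D κ (S.erase j) 1 := by
  induction S using Finset.induction_on_min with
  | empty => simp [wickSet]
  | insert a S h ih =>
    have ha : a ∉ S := fun ha => (h a ha).false
    rw [Finset.sum_insert ha, Finset.erase_insert ha, wickSet_insert μ D κ h, Module.End.mul_apply]
    have h1 : ∀ p, contraction D k (wickOp μ D (κ a) p) =
        D k (κ a) • p + wickOp μ D (κ a) (contraction D k p) := by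
      intro p
      simp only [wickOp_apply, map_add, Derivation.leibniz, contraction_X,
        contraction_comm D k (κ a), Derivation.map_smul, smul_eq_mul]
      simp only [MvPolynomial.smul_eq_C_mul]
      ring
    rw [h1, ih, map_sum]
    congr 1
    refine Finset.sum_congr rfl fun j hj => ?_
    rw [map_smul, Finset.erase_insert_of_ne (fun haj : a = j => ha (haj ▸ hj)),
      wickSet_insert μ D κ fun b hb => h b (Finset.mem_of_mem_erase hb), Module.End.mul_apply]

theorem vacuum_wickSet_insert (μ : σ → ℂ) (D : Matrix σ σ ℂ) (κ : ℕ → σ) {a : ℕ} {S : Finset ℕ}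
    (h : ∀ b ∈ S, a < b) :
    vacuum (wickSet μ D κ (insert a S)) = μ (κ a) * vacuum (wickSet μ D κ S) +
      ∑ j ∈ S, D (κ a) (κ j) * vacuum (wickSet μ D κ (S.erase j)) := by
  rw [wickSet_insert μ D κ h, vacuum_apply, Module.End.mul_apply, wickOp_apply,
    contraction_wickSet]
  simp [vacuum_apply]

end Wick

/-! ### Recursion for the sum over pairings. -/

section Pairings

variable {n : ℕ}

theorem pairEntry_pair (D : Matrix (Idx n) (Idx n) ℂ) (κ : ℕ → Idx n) {a j : ℕ} (h : a < j) :
    pairEntry D κ {a, j} = D (κ a) (κ j) := by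
  have : (({a, j} : Finset ℕ) ×ˢ ({a, j} : Finset ℕ)).filter (fun q => q.1 < q.2) = {(a, j)} := by
    ext ⟨x, y⟩
    simp only [Finset.mem_filter, Finset.mem_product, Finset.mem_insert, Finset.mem_singleton,
      Prod.mk.injEq]
    omega
  rw [pairEntry, this, Finset.prod_singleton]

theorem pairingSum_empty (D : Matrix (Idx n) (Idx n) ℂ) (κ : ℕ → Idx n) :
    pairingSum D κ ∅ = 1 := by
  have h : ∀ P : Finpartition (∅ : Finset ℕ), P.parts = ∅ := fun P =>
    Finpartition.parts_eq_empty_iff.2 rfl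
  have : Unique (Finpartition (∅ : Finset ℕ)) :=
    inferInstanceAs (Unique (Finpartition (⊥ : Finset ℕ)))
  rw [pairingSum, Finset.filter_true_of_mem (by simp [h]), Fintype.sum_unique, h,
    Finset.prod_empty]

/-- Removing the part `{a, j}` from a partition of `insert a S`. -/
theorem exists_finpartition_erase_pair {a j : ℕ} {S : Finset ℕ} (ha : a ∉ S)
    (P : Finpartition (insert a S)) (h : {a, j} ∈ P.parts) :
    ∃ Q : Finpartition (S.erase j), Q.parts = P.parts.erase {a, j} := by
  refine ⟨⟨P.parts.erase {a, j}, P.supIndep.subset (Finset.erase_subset _ _), ?_, ?_⟩, rfl⟩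
  · ext x
    simp only [Finset.mem_sup, Finset.mem_erase, id]
    constructor
    · rintro ⟨p, ⟨hne, hp⟩, hx⟩
      have h1 : x ∉ ({a, j} : Finset ℕ) := fun hx' =>
        hne (P.eq_of_mem_parts hp h hx hx')
      have h2 := P.le hp hx
      simp only [Finset.mem_insert, Finset.mem_singleton, not_or] at h1 h2
      exact ⟨h1.2, h2.resolve_left h1.1⟩
    · rintro ⟨hxj, hxS⟩
      obtain ⟨p, hp, hx⟩ := P.exists_mem (Finset.mem_insert_of_mem hxS)
      refine ⟨p, ⟨?_, hp⟩, hx⟩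
      rintro rfl
      simp only [Finset.mem_insert, Finset.mem_singleton] at hx
      rcases hx with rfl | rfl
      · exact ha hxS
      · exact hxj rfl
  · exact fun h0 => P.bot_notMem (Finset.mem_of_mem_erase h0)

/-- Adding the part `{a, j}` to a partition of `S \\ {j}`. -/
def insertPair {a j : ℕ} {S : Finset ℕ} (ha : a ∉ S) (hj : j ∈ S)
    (Q : Finpartition (S.erase j)) : Finpartition (insert a S) :=
  Q.extend (b := {a, j}) (c := insert a S) (Finset.insert_ne_empty _ _)
    (by
      rw [Finset.disjoint_left]
      intro x hx hx'
      simp only [Finset.mem_insert, Finset.mem_singleton, Finset.mem_erase] at hx hx'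
      rcases hx' with rfl | rfl
      · exact ha hx.2
      · exact hx.1 rfl)
    (by
      ext x
      simp only [Finset.sup_eq_union, Finset.mem_union, Finset.mem_insert, Finset.mem_singleton,
        Finset.mem_erase]
      grind)

theorem parts_insertPair {a j : ℕ} {S : Finset ℕ} (ha : a ∉ S) (hj : j ∈ S)
    (Q : Finpartition (S.erase j)) : (insertPair ha hj Q).parts = insert {a, j} Q.parts := rfl

/-- Pairings are sorted by the partner `j` of the least element `a`; minimality of `a` makes the
entry of that pair `D (κ a) (κ j)` in this order. -/
theorem pairingSum_insert (D : Matrix (Idx n) (Idx n) ℂ) (κ : ℕ → Idx n) {a : ℕ} {S : Finset ℕ}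
    (h : ∀ b ∈ S, a < b) :
    pairingSum D κ (insert a S) =
      ∑ j ∈ S, D (κ a) (κ j) * pairingSum D κ (S.erase j) := by
  have ha : a ∉ S := fun ha => (h a ha).false
  simp only [pairingSum, Finset.mul_sum]
  rw [Finset.sum_sigma']
  symm
  have hdis' : ∀ j j' (Q : Finpartition (S.erase j')), {a, j} ∉ Q.parts := fun j j' Q hQ => by
    have := Q.le hQ (Finset.mem_insert_self a _)
    exact ha (Finset.mem_of_mem_erase this)
  refine Finset.sum_bij
    (fun (q : Σ j, Finpartition (S.erase j)) hq =>
      insertPair ha (Finset.mem_sigma.1 hq).1 q.2) ?_ ?_ ?_ ?_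
  · rintro ⟨j, Q⟩ hq
    obtain ⟨hj, hQ⟩ := Finset.mem_sigma.1 hq
    simp only [Finset.mem_filter, Finset.mem_univ, true_and] at hQ ⊢
    intro p hp
    rw [parts_insertPair, Finset.mem_insert] at hp
    rcases hp with rfl | hp
    · exact Finset.card_pair (h j hj).ne
    · exact hQ p hp
  · rintro ⟨j, Q⟩ hq ⟨j', Q'⟩ hq' heq
    have hparts : insert {a, j} Q.parts = insert {a, j'} Q'.parts := congrArg (·.parts) heq
    have h1 : ({a, j} : Finset ℕ) = {a, j'} := by
      have : {a, j} ∈ insert {a, j'} Q'.parts := hparts ▸ Finset.mem_insert_self _ _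
      exact (Finset.mem_insert.1 this).resolve_right (hdis' j j' Q')
    obtain rfl : j = j' := by
      have : j ∈ ({a, j'} : Finset ℕ) := h1 ▸ by simp
      rcases Finset.mem_insert.1 this with rfl | h2
      · exact absurd (Finset.mem_sigma.1 hq).1 ha
      · exact Finset.mem_singleton.1 h2
    have h2 : Q.parts = Q'.parts := by
      rw [← Finset.erase_insert (hdis' j j Q), hparts, Finset.erase_insert (hdis' j j Q')]
    rw [Finpartition.ext h2]
  · intro P hP
    simp only [Finset.mem_filter, Finset.mem_univ, true_and] at hP
    obtain ⟨p, hp, hap⟩ := P.exists_mem (Finset.mem_insert_self a S)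
    obtain ⟨j, rfl⟩ : ∃ j, p = {a, j} := by
      obtain ⟨x, y, -, rfl⟩ := Finset.card_eq_two.1 (hP p hp)
      rcases Finset.mem_insert.1 hap with rfl | h1
      · exact ⟨y, rfl⟩
      · rw [Finset.mem_singleton.1 h1]; exact ⟨x, Finset.pair_comm _ _⟩
    have hj : j ∈ S := by
      refine (Finset.mem_insert.1 (P.le hp (by simp : j ∈ ({a, j} : Finset ℕ)))).resolve_left ?_
      rintro rfl
      simpa using hP _ hp
    obtain ⟨Q, hQ⟩ := exists_finpartition_erase_pair ha P hp
    refine ⟨⟨j, Q⟩, ?_, ?_⟩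
    · simp only [Finset.mem_sigma, Finset.mem_filter, Finset.mem_univ, true_and]
      exact ⟨hj, fun p hp => hP p (Finset.mem_of_mem_erase (hQ ▸ hp))⟩
    · refine Finpartition.ext ?_
      rw [parts_insertPair, hQ, Finset.insert_erase hp]
  · rintro ⟨j, Q⟩ hq
    rw [parts_insertPair, Finset.prod_insert (hdis' j j Q),
      pairEntry_pair D κ (h j (Finset.mem_sigma.1 hq).1)]

/-- The Gaussian moments as the vacuum expectation of a product of Wick operators. -/
theorem vacuum_wickSet (μ : Idx n → ℂ) (D : Matrix (Idx n) (Idx n) ℂ) (κ : ℕ → Idx n)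
    (I : Finset ℕ) :
    vacuum (wickSet μ D κ I) = ∑ I₁ ∈ I.powerset, vecSet μ κ I₁ * pairingSum D κ (I \ I₁) := by
  induction hN : I.card using Nat.strong_induction_on generalizing I with
  | _ N ih =>
  subst hN
  rcases I.eq_empty_or_nonempty with rfl | hI
  · simp [wickSet, vacuum_one, vecSet, pairingSum_empty]
  obtain ⟨a, S, h, rfl⟩ : ∃ a S, (∀ b ∈ S, a < b) ∧ I = insert a S :=
    ⟨I.min' hI, I.erase (I.min' hI), fun b hb => Finset.min'_lt_of_mem_erase_min' _ _ hb,
      (Finset.insert_erase (I.min'_mem hI)).symm⟩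
  have ha : a ∉ S := fun ha => (h a ha).false
  -- Subsets `I₁` that contain `a` yield the term with `μ`; for the others `a` is paired with some
  -- `j ∈ S \ I₁`.
  rw [vacuum_wickSet_insert μ D κ h, ih _ (by simp [ha]) S rfl, Finset.sum_powerset_insert ha,
    add_comm, Finset.mul_sum]
  congr 1
  · have h1 : ∀ I₁ ∈ S.powerset, vecSet μ κ I₁ * pairingSum D κ (insert a S \ I₁) =
        ∑ j ∈ S \ I₁, D (κ a) (κ j) * (vecSet μ κ I₁ * pairingSum D κ (S.erase j \ I₁)) := by
      intro I₁ hI₁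
      rw [Finset.insert_sdiff_of_notMem _ fun h' => ha (Finset.mem_powerset.1 hI₁ h'),
        pairingSum_insert D κ fun b hb => h b (Finset.mem_sdiff.1 hb).1, Finset.mul_sum]
      refine Finset.sum_congr rfl fun j _ => ?_
      rw [show (S \ I₁).erase j = S.erase j \ I₁ by grind]
      ring
    rw [Finset.sum_congr rfl h1]
    have h2 : ∀ j ∈ S, D (κ a) (κ j) * vacuum (wickSet μ D κ (S.erase j)) =
        ∑ I₁ ∈ (S.erase j).powerset,
          D (κ a) (κ j) * (vecSet μ κ I₁ * pairingSum D κ (S.erase j \ I₁)) := by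
      intro j hj
      rw [ih _ ((Finset.card_lt_card (Finset.erase_ssubset hj)).trans (by simp [ha])) _ rfl,
        Finset.mul_sum]
    rw [Finset.sum_congr rfl h2]
    refine Finset.sum_comm' fun j I₁ => ?_
    simp only [Finset.mem_powerset, Finset.mem_sdiff, Finset.subset_erase]
    tauto
  · refine Finset.sum_congr rfl fun I₁ hI₁ => ?_
    have ha₁ : a ∉ I₁ := fun h' => ha (Finset.mem_powerset.1 hI₁ h')
    rw [vecSet, vecSet, Finset.prod_insert ha₁, mul_assoc]
    congr 3
    ext x
    simp only [Finset.mem_sdiff, Finset.mem_insert]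
    grind

end Pairings

end Fock

namespace Fock

variable {n : ℕ}

/-! ### Ladder operators on coefficient sequences. -/

section Ladder

theorem annihilate_mul_create (i j : Fin n) :
    (annihilate i : Module.End ℂ ((Fin n → ℕ) → ℂ)) * create j =
      create j * annihilate i + algebraMap ℂ _ ((1 : Matrix (Fin n) (Fin n) ℂ) i j) := by
  refine LinearMap.ext fun ψ => funext fun m => ?_
  simp only [Module.End.mul_apply, LinearMap.add_apply, Module.algebraMap_end_apply,
    Pi.add_apply, Pi.smul_apply, annihilate, create, LinearMap.coe_mk, AddHom.coe_mk]
  by_cases h : i = j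
  · subst h
    have h1 : ((Real.sqrt (m i + 1) : ℝ) : ℂ) * (Real.sqrt (m i + 1) : ℝ) = m i + 1 := by
      rw [← Complex.ofReal_mul, Real.mul_self_sqrt (by positivity)]; push_cast; rfl
    have h2 : ((Real.sqrt (m i) : ℝ) : ℂ) * (Real.sqrt (m i) : ℝ) = m i := by
      rw [← Complex.ofReal_mul, Real.mul_self_sqrt (by positivity)]; push_cast; rfl
    simp only [Pi.single_eq_same, add_tsub_cancel_right, Nat.cast_add,
      Nat.cast_one, ← mul_assoc, h1, Matrix.one_apply_eq, one_smul]
    -- At `m i = 0` the truncated subtraction is not undone by adding `e_i`, but the factor `√(m i)`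
    -- vanishes.
    rcases Nat.eq_zero_or_pos (m i) with h0 | h0
    · simp [h0]
    · have h3 : m - Pi.single i 1 + Pi.single i 1 = m := by
        ext x
        by_cases hx : x = i
        · subst hx; simp; omega
        · simp [hx]
      have h4 : (((m - Pi.single i 1 : Fin n → ℕ) i : ℕ) : ℝ) + 1 = m i := by
        simp only [Pi.sub_apply, Pi.single_eq_same]
        exact_mod_cast Nat.sub_add_cancel h0
      rw [h3, h4, h2]; ring
  · have h1 : m + Pi.single i 1 - Pi.single j 1 = m - Pi.single j 1 + Pi.single i 1 := by
      ext x
      by_cases hx : x = j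
      · subst hx; simp [Pi.single_eq_of_ne (Ne.symm h)]
      · simp [hx]
    simp [Pi.single_eq_of_ne h, Pi.single_eq_of_ne (Ne.symm h), h1, Matrix.one_apply_ne h]; ring

theorem annihilate_mul_annihilate (i j : Fin n) :
    (annihilate i : Module.End ℂ ((Fin n → ℕ) → ℂ)) * annihilate j =
      annihilate j * annihilate i := by
  by_cases h : i = j
  · rw [h]
  · refine LinearMap.ext fun ψ => funext fun m => ?_
    simp [annihilate, Pi.single_eq_of_ne h, Pi.single_eq_of_ne (Ne.symm h), add_right_comm]; ring

theorem create_mul_create (i j : Fin n) :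
    (create i : Module.End ℂ ((Fin n → ℕ) → ℂ)) * create j = create j * create i := by
  by_cases h : i = j
  · rw [h]
  · refine LinearMap.ext fun ψ => funext fun m => ?_
    simp [create, Pi.single_eq_of_ne h, Pi.single_eq_of_ne (Ne.symm h), tsub_right_comm]; ring

/-- The canonical commutation relations. -/
theorem ladder_commutator (k l : Idx n) :
    (ladder k : Module.End ℂ ((Fin n → ℕ) → ℂ)) * ladder l =
      ladder l * ladder k + algebraMap ℂ _ (-(Matrix.J (Fin n) ℂ k l)) := by
  rcases k with i | i <;> rcases l with j | j
  · simpa [ladder, Matrix.J] using annihilate_mul_annihilate i j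
  · simpa [ladder, Matrix.J] using annihilate_mul_create i j
  · simp [ladder, Matrix.J, annihilate_mul_create j i, Matrix.one_apply, eq_comm]
  · simpa [ladder, Matrix.J] using create_mul_create i j

/-- Continuity is for pointwise convergence: each output coordinate depends on one input coordinate.
Thus operators unbounded on `ℓ²` may still be applied to convergent series term by term. -/
theorem continuous_ladder (k : Idx n) : Continuous (ladder k) := by
  rcases k with j | j
  · refine continuous_pi fun l => ?_
    exact continuous_const.mul (continuous_apply _)
  · refine continuous_pi fun l => ?_
    exact continuous_const.mul (continuous_apply _)

theorem continuous_ladder_prod (w : List (Idx n)) :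
    Continuous ((w.map ladder).prod : Module.End ℂ ((Fin n → ℕ) → ℂ)) := by
  induction w with
  | nil => exact continuous_id
  | cons k w ih => exact (continuous_ladder k).comp ih

theorem continuous_field_pow (z : Fin n → ℂ) (m : ℕ) : Continuous (field z ^ m) := by
  have h1 : Continuous (field z) := by
    have : (field z : ((Fin n → ℕ) → ℂ) → ((Fin n → ℕ) → ℂ)) =
        fun ψ => ∑ k, bar z k • ladder k ψ := by
      ext ψ; simp [field, LinearMap.sum_apply]
    rw [this]
    exact continuous_finsetSum _ fun k _ =>
      (continuous_const_smul (bar z k)).comp (continuous_ladder k)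
  induction m with
  | zero => exact continuous_id
  | succ m ih => rw [pow_succ']; exact h1.comp ih

theorem bar_add_smul (z w : Fin n → ℂ) (t : ℝ) : bar (z + t • w) = bar z + (t : ℂ) • bar w := by
  ext k
  rcases k with j | j <;> simp [bar]

theorem bar_smul (z : Fin n → ℂ) (t : ℝ) : bar (t • z) = (t : ℂ) • bar z := by
  ext k
  rcases k with j | j <;> simp [bar]

theorem field_smul (z : Fin n → ℂ) (t : ℝ) : field (t • z) = (t : ℂ) • field z := by
  simp [field, bar_smul, Finset.smul_sum, smul_smul]

theorem fieldPow_smul (z : Fin n → ℂ) (t : ℝ) (m : ℕ) (k : Fin n → ℕ) :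
    fieldPow (t • z) m k = (t : ℂ) ^ m • fieldPow z m k := by
  ext l
  simp only [fieldPow, fieldPowFun, field_smul, lp.coeFn_smul, Pi.smul_apply]
  rw [smul_pow]; rfl

theorem expTerm_smul (z : Fin n → ℂ) (t : ℝ) (k : Fin n → ℕ) (m : ℕ) :
    expTerm (t • z) k m = (t : ℂ) ^ m • expTerm z k m := by
  rw [expTerm, expTerm, fieldPow_smul, smul_comm]

end Ladder

/-! ### Expansion in number states. -/

section Kets

theorem inner_ket_left (k : Fin n → ℕ) (ψ : Fock n) : ⟪ket k, ψ⟫_ℂ = ψ k := by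
  classical
  simp [ket, lp.inner_single_left]

theorem hasSum_ket (ψ : Fock n) : HasSum (fun k => ψ k • ket k) ψ := by
  have h := lp.hasSum_single (p := 2) (by simp) ψ
  have h1 : (fun k => ψ k • ket k) = fun k => lp.single 2 k (ψ k) := by
    ext1 k
    rw [ket, ← lp.single_smul, smul_eq_mul, mul_one]
  rwa [h1]

theorem ext_ket {E : Type*} [NormedAddCommGroup E] [NormedSpace ℂ E] {S T : Fock n →L[ℂ] E}
    (h : ∀ k, S (ket k) = T (ket k)) : S = T := by
  ext1 ψ
  refine ((hasSum_ket ψ).mapL S).unique ?_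
  have := (hasSum_ket ψ).mapL T
  simpa only [map_smul, h] using this

theorem continuous_coe : Continuous fun (ψ : Fock n) => (ψ : (Fin n → ℕ) → ℂ) :=
  lp.uniformContinuous_coe.continuous

/-- Both sides are continuous in `ψ`, and on number states they agree by the symmetry of the field.
On the right `(field z ^ m) ψ` is only a sequence; it may fail to lie in `ℓ²`. -/
theorem inner_fieldPow_left (z : Fin n → ℂ) (m : ℕ) (k : Fin n → ℕ) (ψ : Fock n) :
    ⟪fieldPow z m k, ψ⟫_ℂ = (field z ^ m) ψ k := by
  let T : Fock n →L[ℂ] ℂ :=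
    { toFun := fun ψ => (field z ^ m) ψ k
      map_add' := fun ψ φ => by rw [lp.coeFn_add, map_add]; rfl
      map_smul' := fun c ψ => by rw [lp.coeFn_smul, map_smul]; rfl
      cont := (continuous_apply k).comp ((continuous_field_pow z m).comp continuous_coe) }
  have : innerSL ℂ (fieldPow z m k) = T := by
    refine ext_ket fun l => ?_
    have h1 := inner_fieldPow z k l m 0
    rw [fieldPow_zero, fieldPow_zero, add_zero, inner_ket_left] at h1
    have h2 : ((ket l : Fock n) : (Fin n → ℕ) → ℂ) = Pi.single l 1 := by
      ext x
      simp [ket, Pi.single_apply]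
    rw [innerSL_apply_apply, h1]
    show fieldPowFun z m l k = (field z ^ m) (ket l : Fock n) k
    rw [h2]; rfl
  exact DFunLike.congr_fun this ψ

end Kets

/-! ### One-parameter Weyl groups and their difference quotients. -/

section Weyl

theorem weyl_ket (z : Fin n → ℂ) (k : Fin n → ℕ) : weyl z (ket k) = expVec z k :=
  (hasSum_weyl_ket z k).unique (hasSum_expVec z k)

/-- In the double series all powers of the field move to the right by symmetry; the binomial theorem
then sums each antidiagonal to `(i (t - s))^N / N!`. -/
theorem inner_expVec_smul (z : Fin n → ℂ) (s t : ℝ) (k l : Fin n → ℕ) :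
    ⟪expVec (s • z) k, expVec (t • z) l⟫_ℂ = ⟪ket k, expVec ((t - s) • z) l⟫_ℂ := by
  set F : ℕ × ℕ → ℂ := fun q => ⟪expTerm (s • z) k q.1, expTerm (t • z) l q.2⟫_ℂ with hF
  have hs : Summable F := by
    refine Summable.of_norm_bounded
      ((summable_norm_expTerm (s • z) k).mul_of_nonneg (summable_norm_expTerm (t • z) l)
        (fun _ => norm_nonneg _) (fun _ => norm_nonneg _)) fun q => norm_inner_le_norm _ _
  have h1 : HasSum F ⟪expVec (s • z) k, expVec (t • z) l⟫_ℂ := by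
    have hin : ∀ m, HasSum (fun p => F (m, p)) ⟪expTerm (s • z) k m, expVec (t • z) l⟫_ℂ :=
      fun m => (hasSum_expVec (t • z) l).mapL (innerSL ℂ (expTerm (s • z) k m))
    have hout : HasSum (fun m => ⟪expTerm (s • z) k m, expVec (t • z) l⟫_ℂ)
        ⟪expVec (s • z) k, expVec (t • z) l⟫_ℂ := by
      have := ((hasSum_expVec (s • z) k).mapL (innerSL ℂ (expVec (t • z) l))).star
      simpa [inner_conj_symm] using this
    have := hs.hasSum.prod_fiberwise hin
    rw [← this.unique hout]
    exact hs.hasSum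
  have h2 := (Finset.HasAntidiagonal.sigmaAntidiagonalEquivProd (A := ℕ)).hasSum_iff.2 h1
  have h3 := h2.sigma fun N => hasSum_fintype _
  refine h3.unique ?_
  have hz : ∀ N : ℕ, ⟪ket k, expTerm ((t - s) • z) l N⟫_ℂ =
      ∑ c : Finset.HasAntidiagonal.antidiagonal N,
        (F ∘ Finset.HasAntidiagonal.sigmaAntidiagonalEquivProd) ⟨N, c⟩ := by
    intro N
    have e : (∑ c : Finset.HasAntidiagonal.antidiagonal N,
        (F ∘ Finset.HasAntidiagonal.sigmaAntidiagonalEquivProd) ⟨N, c⟩) =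
        ∑ c ∈ Finset.HasAntidiagonal.antidiagonal N, F c :=
      Finset.sum_coe_sort (Finset.HasAntidiagonal.antidiagonal N) F
    rw [e]
    have hterm : ∀ c ∈ Finset.HasAntidiagonal.antidiagonal N, F c =
        (1 / (N.factorial : ℂ) * ⟪fieldPow z 0 k, fieldPow z N l⟫_ℂ) *
          (N.choose c.1 • ((-(Complex.I * s)) ^ c.1 * (Complex.I * t) ^ c.2)) := by
      rintro ⟨a, b⟩ hab
      rw [Finset.HasAntidiagonal.mem_antidiagonal] at hab
      subst hab
      simp only [hF, expTerm_smul]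
      simp only [expTerm, inner_smul_left, inner_smul_right, inner_fieldPow z k l a b]
      have hf : ((a + b).factorial : ℂ) = (a + b).choose a * a.factorial * b.factorial := by
        rw [Nat.choose_symm_add]
        exact_mod_cast (Nat.add_choose_mul_factorial_mul_factorial a b).symm
      have h4 : ((a + b).choose a : ℂ) ≠ 0 := by
        exact_mod_cast (Nat.choose_pos (Nat.le_add_right a b)).ne'
      have h5 : (a.factorial : ℂ) ≠ 0 := by exact_mod_cast a.factorial_ne_zero
      have h6 : (b.factorial : ℂ) ≠ 0 := by exact_mod_cast b.factorial_ne_zero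
      rw [hf, neg_mul_eq_neg_mul, mul_pow, mul_pow]
      simp only [map_div₀, map_pow, Complex.conj_I, Complex.conj_natCast, nsmul_eq_mul,
        Complex.conj_ofReal]
      field_simp
    rw [Finset.sum_congr rfl hterm, ← Finset.mul_sum,
      ← (Commute.all (-(Complex.I * s)) (Complex.I * t)).add_pow' N, expTerm_smul, expTerm,
      inner_smul_right, inner_smul_right, ← fieldPow_zero z k, fieldPow_zero z k,
      show -(Complex.I * s) + Complex.I * t = Complex.I * ((t - s : ℝ) : ℂ) by push_cast; ring,
      mul_pow]
    ring
  simp_rw [← hz]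
  exact (hasSum_expVec ((t - s) • z) l).mapL (innerSL ℂ (ket k))

theorem adjoint_weyl_comp_weyl (z : Fin n → ℂ) (s t : ℝ) :
    (weyl (s • z)).adjoint ∘L weyl (t • z) = weyl ((t - s) • z) := by
  refine ext_ket fun l => lp.ext <| funext fun k => ?_
  rw [← inner_ket_left, ← inner_ket_left, ContinuousLinearMap.comp_apply,
    ContinuousLinearMap.adjoint_inner_right, weyl_ket, weyl_ket, weyl_ket, inner_expVec_smul]

theorem weyl_zero : weyl (0 : Fin n → ℂ) = 1 := by
  refine ext_ket fun l => lp.ext <| funext fun k => ?_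
  have h := adjoint_weyl_comp_weyl (0 : Fin n → ℂ) 0 0
  simp only [smul_zero] at h
  rw [← inner_ket_left, ← h, ContinuousLinearMap.comp_apply,
    ContinuousLinearMap.adjoint_inner_right, weyl_ket, weyl_ket, inner_expVec, inner_ket_left,
    one_apply_eq_self]

theorem adjoint_weyl (z : Fin n → ℂ) : (weyl z).adjoint = weyl (-z) := by
  have h := adjoint_weyl_comp_weyl z 1 0
  rw [zero_smul, weyl_zero, zero_sub, neg_smul, one_smul] at h
  exact h

theorem weyl_mul_weyl (z : Fin n → ℂ) (s t : ℝ) :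
    weyl (s • z) * weyl (t • z) = weyl ((s + t) • z) := by
  have h := adjoint_weyl_comp_weyl z (-s) t
  rw [adjoint_weyl, neg_smul, neg_neg, sub_neg_eq_add, add_comm] at h
  exact h

theorem weyl_pow (z : Fin n → ℂ) (k : ℕ) : weyl z ^ k = weyl ((k : ℝ) • z) := by
  induction k with
  | zero => simp [weyl_zero]
  | succ k ih =>
    have := weyl_mul_weyl z k 1
    rw [one_smul] at this
    rw [pow_succ, ih, this]
    push_cast; rfl

/-- The difference `exp (i 𝐳ᵀ 𝔞) - exp (-i 𝐳ᵀ 𝔞)`. -/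
def weylDiff (z : Fin n → ℂ) : Fock n →L[ℂ] Fock n := weyl z - weyl (-z)

theorem adjoint_weylDiff (z : Fin n → ℂ) : (weylDiff z).adjoint = -weylDiff z := by
  rw [weylDiff, map_sub, adjoint_weyl, adjoint_weyl, neg_neg, neg_sub]

theorem adjoint_weylDiff_pow (z : Fin n → ℂ) (m : ℕ) :
    (weylDiff z ^ m).adjoint = (-1 : ℂ) ^ m • weylDiff z ^ m := by
  rw [← ContinuousLinearMap.star_eq_adjoint, star_pow, ContinuousLinearMap.star_eq_adjoint,
    adjoint_weylDiff, ← neg_one_smul ℂ, smul_pow]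

/-- The two Weyl operators commute, and `W(tz)^k W(-tz)^(m-k) = W((2k-m)tz)` by the group law on a
ray. -/
theorem weylDiff_pow_apply (z : Fin n → ℂ) (m : ℕ) (t : ℝ) (ψ : Fock n) :
    (weylDiff (t • z) ^ m) ψ = centralDiff m (fun s => weyl (s • z) ψ) t := by
  have hcomm : Commute (weyl (t • z)) (-weyl (-(t • z))) := by
    refine Commute.neg_right ?_
    rw [← neg_smul, Commute, SemiconjBy, weyl_mul_weyl, weyl_mul_weyl, add_comm]
  rw [weylDiff, sub_eq_add_neg, hcomm.add_pow, sum_apply, centralDiff]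
  refine Finset.sum_congr rfl fun k hk => ?_
  have hk' : k ≤ m := by simpa [Nat.lt_succ_iff] using hk
  have h1 : weyl (t • z) ^ k * weyl (-(t • z)) ^ (m - k) = weyl (((2 * k - m) * t) • z) := by
    rw [← neg_smul, weyl_pow, weyl_pow, smul_smul, smul_smul, weyl_mul_weyl]
    congr 2
    push_cast [hk']
    ring
  have h2 : (-weyl (-(t • z))) ^ (m - k) = (-1 : ℝ) ^ (m - k) • weyl (-(t • z)) ^ (m - k) := by
    rw [← neg_one_smul ℝ, smul_pow]
  rw [h2, mul_smul_comm, h1, ← (m.choose k).cast_comm, ← nsmul_eq_mul, smul_apply, smul_apply,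
    ← Nat.cast_smul_eq_nsmul ℝ, smul_smul, mul_comm]

/-- For `|s| ≤ 1` the tail is at most `|s|^(m+1)` times the sum of the norms of its coefficients. -/
theorem isLittleO_powerSeries {E : Type*} [NormedAddCommGroup E] [NormedSpace ℝ E]
    {f : ℝ → E} {c : ℕ → E} (hc : Summable fun p => ‖c p‖)
    (hf : ∀ s, HasSum (fun p => s ^ p • c p) (f s)) (m : ℕ) :
    (fun s => f s - ∑ k ∈ Finset.range (m + 1), s ^ k • c k) =o[𝓝 0] fun s : ℝ => s ^ m := by
  refine IsBigO.trans_isLittleO (g := fun s : ℝ => s ^ (m + 1)) ?_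
    (isLittleO_pow_pow (Nat.lt_succ_self m))
  refine IsBigO.of_bound (∑' p, ‖c (p + (m + 1))‖) ?_
  have hc' := (summable_nat_add_iff (m + 1)).2 hc
  filter_upwards [Metric.ball_mem_nhds (0 : ℝ) one_pos] with s hs
  have hs1 : |s| ≤ 1 := by simpa using (mem_ball_zero_iff.1 hs).le
  have h1 := (hasSum_nat_add_iff' (m + 1)).2 (hf s)
  rw [← h1.tsum_eq, mul_comm, ← tsum_mul_left]
  refine tsum_of_norm_bounded (hc'.mul_left _).hasSum fun p => ?_
  rw [norm_smul, pow_add, norm_mul]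
  have : ‖s ^ p‖ ≤ 1 := by
    rw [norm_pow]; exact pow_le_one₀ (norm_nonneg _) hs1
  calc ‖s ^ p‖ * ‖s ^ (m + 1)‖ * ‖c (p + (m + 1))‖
      ≤ 1 * ‖s ^ (m + 1)‖ * ‖c (p + (m + 1))‖ := by gcongr
    _ = _ := by rw [one_mul]

theorem real_smul_eq (r : ℝ) (ψ : Fock n) : r • ψ = (r : ℂ) • ψ :=
  (Complex.coe_smul r ψ).symm

theorem tendsto_weylDiff_ket (z : Fin n → ℂ) (m : ℕ) (k : Fin n → ℕ) :
    Tendsto (fun t : ℝ => ((2 * t) ^ m)⁻¹ • (weylDiff (t • z) ^ m) (ket k)) (𝓝[≠] 0)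
      (𝓝 (Complex.I ^ m • fieldPow z m k)) := by
  have h := tendsto_centralDiff m (fun s => weyl (s • z) (ket k)) (expTerm z k)
    (isLittleO_powerSeries (summable_norm_expTerm z k) (fun s => ?_) m)
  · simp only [← weylDiff_pow_apply] at h
    have h1 : (m.factorial : ℝ) • expTerm z k m = Complex.I ^ m • fieldPow z m k := by
      rw [expTerm, Nat.cast_smul_eq_nsmul, ← Nat.cast_smul_eq_nsmul ℂ, smul_smul,
        mul_div_cancel₀ _ (by exact_mod_cast m.factorial_ne_zero)]
    rwa [h1] at h
  · rw [weyl_ket]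
    have h := hasSum_expVec (s • z) k
    simp only [funext fun p => expTerm_smul z s k p] at h
    have h1 : (fun p => s ^ p • expTerm z k p) = fun p => (s : ℂ) ^ p • expTerm z k p := by
      ext1 p
      rw [← Complex.ofReal_pow]; exact real_smul_eq _ _
    rwa [h1]

/-- The matrix elements of the difference quotients of the Weyl operators converge to those of
the powers of the field operator, on arbitrary vectors. -/
theorem tendsto_weylDiff_apply (z : Fin n → ℂ) (m : ℕ) (ψ : Fock n) (k : Fin n → ℕ) :
    Tendsto (fun t : ℝ => ((2 * Complex.I * t) ^ m)⁻¹ * (weylDiff (t • z) ^ m) ψ k) (𝓝[≠] 0)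
      (𝓝 ((field z ^ m) ψ k)) := by
  -- The difference operator is moved to the number state, where it converges in norm;
  -- skew-adjointness accounts for `(-1)^m`.
  have h1 := (tendsto_weylDiff_ket z m k).inner (𝕜 := ℂ) (tendsto_const_nhds (x := ψ))
  have h2 := h1.const_mul ((Complex.I ^ m)⁻¹ * (-1) ^ m)
  have h3 : (Complex.I ^ m)⁻¹ * (-1) ^ m * ⟪Complex.I ^ m • fieldPow z m k, ψ⟫_ℂ =
      (field z ^ m) ψ k := by
    rw [inner_smul_left, inner_fieldPow_left, map_pow, Complex.conj_I, ← mul_assoc, ← inv_pow,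
      ← mul_pow, ← mul_pow, Complex.inv_I]
    simp
  rw [h3] at h2
  refine h2.congr fun t => ?_
  rw [← inner_ket_left, ← ContinuousLinearMap.adjoint_inner_left, adjoint_weylDiff_pow, smul_apply,
    inner_smul_left, real_smul_eq, inner_smul_left]
  simp only [map_pow, map_neg, map_one, Complex.conj_ofReal]
  push_cast
  rw [mul_pow, mul_pow, mul_pow, mul_inv, mul_inv, mul_inv]
  ring

end Weyl
end Fock

/-! ### Square summable families and weak convergence. -/

section SquareSummable

variable {α β : Type*}

theorem memℓp_two_iff {E : α → Type*} [∀ i, NormedAddCommGroup (E i)] {f : ∀ i, E i} :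
    Memℓp f 2 ↔ Summable fun i => ‖f i‖ ^ 2 := by
  rw [memℓp_gen_iff (by simp)]
  simp

theorem lp_two_hasSum_norm_sq (f : lp (fun _ : α => ℂ) 2) :
    HasSum (fun i => ‖f i‖ ^ 2) (‖f‖ ^ 2) := by
  have := lp.hasSum_norm (p := 2) (by simp) f
  simpa using this

/-- A square summable family in `ℓ²(β)` is an element of `ℓ²(α × β)`. -/
theorem memℓp_uncurry {y : α → lp (fun _ : β => ℂ) 2} (hy : Summable fun i => ‖y i‖ ^ 2) :
    Memℓp (fun p : α × β => y p.1 p.2) 2 := by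
  rw [memℓp_two_iff, summable_prod_of_nonneg fun p => by positivity]
  refine ⟨fun i => (lp_two_hasSum_norm_sq (y i)).summable, ?_⟩
  simpa only [fun i => (lp_two_hasSum_norm_sq (y i)).tsum_eq] using hy

/-- A square summable family in `ℓ²(β)`, as an element of `ℓ²(α × β)`. -/
def lpUncurry (y : α → lp (fun _ : β => ℂ) 2) (hy : Summable fun i => ‖y i‖ ^ 2) :
    lp (fun _ : α × β => ℂ) 2 := ⟨_, memℓp_uncurry hy⟩

theorem hasSum_inner_lpUncurry {x y : α → lp (fun _ : β => ℂ) 2}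
    (hx : Summable fun i => ‖x i‖ ^ 2) (hy : Summable fun i => ‖y i‖ ^ 2) :
    HasSum (fun i => ⟪x i, y i⟫_ℂ) ⟪lpUncurry x hx, lpUncurry y hy⟫_ℂ :=
  (lp.hasSum_inner (lpUncurry x hx) (lpUncurry y hy)).prod_fiberwise
    fun i => lp.hasSum_inner (x i) (y i)

theorem exists_of_memℓp_uncurry {y : α → β → ℂ} (h : Memℓp (fun p : α × β => y p.1 p.2) 2) :
    ∃ y' : α → lp (fun _ : β => ℂ) 2, (∀ i, (y' i : β → ℂ) = y i) ∧
      Summable fun i => ‖y' i‖ ^ 2 := by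
  rw [memℓp_two_iff, summable_prod_of_nonneg fun p => by positivity] at h
  refine ⟨fun i => ⟨y i, memℓp_two_iff.2 (h.1 i)⟩, fun i => rfl, ?_⟩
  exact h.2.congr fun i => (lp_two_hasSum_norm_sq ⟨y i, memℓp_two_iff.2 (h.1 i)⟩).tsum_eq

/-- A pointwise limit of bounded vectors of `ℓ²` is in `ℓ²`. -/
theorem memℓp_two_of_tendsto {γ : Type*} {l : Filter γ} [l.NeBot] {F : γ → lp (fun _ : α => ℂ) 2}
    {B : ℝ} (hF : ∀ᶠ t in l, ‖F t‖ ≤ B) {f : α → ℂ} (h : ∀ i, Tendsto (fun t => F t i) l (𝓝 (f i))) :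
    Memℓp f 2 := by
  have hB : 0 ≤ B := by
    obtain ⟨t, ht⟩ := hF.exists
    exact (norm_nonneg _).trans ht
  refine memℓp_two_iff.2 (summable_of_sum_le (c := B ^ 2) (fun i => by positivity) fun s => ?_)
  refine le_of_tendsto (tendsto_finsetSum s fun i _ => ((h i).norm.pow 2)) ?_
  filter_upwards [hF] with t ht
  calc ∑ i ∈ s, ‖F t i‖ ^ 2 ≤ ‖F t‖ ^ 2 :=
        sum_le_hasSum s (fun i _ => by positivity) (lp_two_hasSum_norm_sq (F t))
    _ ≤ B ^ 2 := by gcongr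

/-- Bounded pointwise convergence in `ℓ²` implies weak convergence. -/
theorem tendsto_inner_of_tendsto {γ : Type*} {l : Filter γ} {F : γ → lp (fun _ : α => ℂ) 2}
    {B : ℝ} (hF : ∀ᶠ t in l, ‖F t‖ ≤ B) {f : lp (fun _ : α => ℂ) 2}
    (h : ∀ i, Tendsto (fun t => F t i) l (𝓝 (f i))) (b : lp (fun _ : α => ℂ) 2) :
    Tendsto (fun t => ⟪b, F t⟫_ℂ) l (𝓝 ⟪b, f⟫_ℂ) := by
  classical
  rw [tendsto_iff_norm_sub_tendsto_zero]
  simp only [← inner_sub_right]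
  rw [Metric.tendsto_nhds]
  intro ε hε
  set K := |B| + ‖f‖ + 1 with hK
  have hK0 : 0 < K := by positivity
  -- Finite truncations of `b` see only finitely many coordinates; the norm bound `K` controls the
  -- rest.
  obtain ⟨s, hs⟩ := ((lp.hasSum_single (p := 2) (by simp) b).eventually
    (Metric.ball_mem_nhds b (show 0 < ε / 2 / K by positivity))).exists
  set b' := ∑ i ∈ s, lp.single 2 i (b i) with hb'
  have h1 : Tendsto (fun t => ⟪b', F t - f⟫_ℂ) l (𝓝 0) := by
    simp only [hb', sum_inner, lp.inner_single_left, lp.coeFn_sub, Pi.sub_apply]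
    have : (0 : ℂ) = ∑ i ∈ s, ⟪b i, f i - f i⟫_ℂ := by simp
    rw [this]
    exact tendsto_finsetSum s fun i _ => tendsto_const_nhds.inner ((h i).sub_const _)
  filter_upwards [hF, (Metric.tendsto_nhds.1 h1 (ε / 2) (by positivity))] with t ht h2
  rw [dist_zero_right] at h2
  rw [Real.dist_0_eq_abs, abs_norm]
  have h3 : ‖F t - f‖ ≤ K := by
    refine (norm_sub_le _ _).trans ?_
    have := le_abs_self B
    linarith
  have h4 : ‖b - b'‖ < ε / 2 / K := by
    have : dist b' b < _ := hs
    rwa [dist_comm, dist_eq_norm] at this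
  calc ‖⟪b, F t - f⟫_ℂ‖ = ‖⟪b - b', F t - f⟫_ℂ + ⟪b', F t - f⟫_ℂ‖ := by
        rw [← inner_add_left, sub_add_cancel]
    _ ≤ ‖b - b'‖ * ‖F t - f‖ + ‖⟪b', F t - f⟫_ℂ‖ :=
        (norm_add_le _ _).trans (by gcongr; exact norm_inner_le_norm _ _)
    _ < ε / 2 / K * K + ε / 2 := by
        refine add_lt_add_of_le_of_lt ?_ h2
        gcongr
    _ = ε := by field_simp; norm_num

end SquareSummable

namespace Fock

variable {n : ℕ}

/-! ### Traces and the decomposition of density operators. -/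

section TraceClass

theorem inner_ket_right (k : Fin n → ℕ) (ψ : Fock n) : ⟪ψ, ket k⟫_ℂ = conj (ψ k) := by
  rw [← inner_conj_symm, inner_ket_left]

/-- The trace of `∑ᵢ ⟨xᵢ, ·⟩ yᵢ`. -/
theorem trace_eq_tsum_inner {α : Type*} {x y : α → Fock n}
    (h : Summable fun i => ‖x i‖ * ‖y i‖) {T : Fock n →L[ℂ] Fock n}
    (hT : ∀ ψ, HasSum (fun i => ⟪x i, ψ⟫_ℂ • y i) (T ψ)) : trace T = ∑' i, ⟪x i, y i⟫_ℂ := by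
  have hpq : (2 : ENNReal).toReal.HolderConjugate (2 : ENNReal).toReal := by
    simpa using Real.HolderConjugate.two_two
  -- Cauchy–Schwarz for each `i` makes the double series absolutely summable, so the sums over `i`
  -- and `l` may be exchanged.
  have hsum : Summable fun p : α × (Fin n → ℕ) => ⟪x p.1 p.2, y p.1 p.2⟫_ℂ := by
    refine Summable.of_norm ?_
    have hb : ∀ p : α × (Fin n → ℕ), ‖⟪x p.1 p.2, y p.1 p.2⟫_ℂ‖ = ‖x p.1 p.2‖ * ‖y p.1 p.2‖ :=
      fun p => by simp [mul_comm]
    simp only [hb]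
    rw [summable_prod_of_nonneg fun p => by positivity]
    refine ⟨fun i => (lp.tsum_mul_le_mul_norm hpq (x i) (y i)).1, ?_⟩
    exact h.of_nonneg_of_le (fun i => tsum_nonneg fun l => by positivity)
      fun i => (lp.tsum_mul_le_mul_norm hpq (x i) (y i)).2
  have h1 : ∀ l, HasSum (fun i => ⟪x i l, y i l⟫_ℂ) ⟪ket l, T (ket l)⟫_ℂ := by
    intro l
    have h2 := (hT (ket l)).mapL (innerSL ℂ (ket l))
    have h3 : (fun i => ⟪x i l, y i l⟫_ℂ) = fun i => innerSL ℂ (ket l) (⟪x i, ket l⟫_ℂ • y i) := by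
      ext1 i
      rw [innerSL_apply_apply, inner_smul_right, inner_ket_left, inner_ket_right]
      exact mul_comm _ _
    rwa [h3]
  have h4 := hsum.hasSum.prod_fiberwise fun i => lp.hasSum_inner (x i) (y i)
  have h5 := (hsum.prod_symm.hasSum).prod_fiberwise fun l => h1 l
  have h6 : ∑' p : (Fin n → ℕ) × α, ⟪x p.swap.1 p.swap.2, y p.swap.1 p.swap.2⟫_ℂ =
      ∑' p : α × (Fin n → ℕ), ⟪x p.1 p.2, y p.1 p.2⟫_ℂ :=
    (Equiv.prodComm _ _).tsum_eq fun p : α × (Fin n → ℕ) => ⟪x p.1 p.2, y p.1 p.2⟫_ℂ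
  rw [h4.tsum_eq, ← h6]
  exact h5.tsum_eq

theorem isTraceClass_of_hasSum {α : Type*} [Countable α] {x y : α → Fock n}
    (h : Summable fun i => ‖x i‖ * ‖y i‖) {T : Fock n →L[ℂ] Fock n}
    (hT : ∀ ψ, HasSum (fun i => ⟪x i, ψ⟫_ℂ • y i) (T ψ)) : IsTraceClass T := by
  obtain ⟨f, hf⟩ := exists_injective_nat α
  refine ⟨Function.extend f x 0, Function.extend f y 0, ?_, fun ψ => ?_⟩
  · refine (hf.summable_iff fun i hi => ?_).1 ?_
    · rw [Function.extend_apply' _ _ _ (by simpa using hi)]; simp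
    · simpa [Function.comp_def, hf.extend_apply] using h
  · refine (hf.hasSum_iff fun i hi => ?_).1 ?_
    · rw [Function.extend_apply' _ _ _ (by simpa using hi)]; simp
    · simpa [Function.comp_def, hf.extend_apply] using hT ψ

theorem exists_clm_of_summable {α : Type*} {x y : α → Fock n}
    (h : Summable fun i => ‖x i‖ * ‖y i‖) :
    ∃ T : Fock n →L[ℂ] Fock n, ∀ ψ, HasSum (fun i => ⟪x i, ψ⟫_ℂ • y i) (T ψ) := by
  have h1 : Summable fun i => (innerSL ℂ (x i)).smulRight (y i) := by
    refine Summable.of_norm (h.congr fun i => ?_)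
    rw [ContinuousLinearMap.norm_smulRight_apply, innerSL_apply_norm]
  refine ⟨∑' i, (innerSL ℂ (x i)).smulRight (y i), fun ψ => ?_⟩
  exact h1.hasSum.mapL (ContinuousLinearMap.apply ℂ (Fock n) ψ)

/-- Positive operators have self-adjoint square roots. -/
theorem _root_.ContinuousLinearMap.IsPositive.exists_sqrt {H : Type*} [NormedAddCommGroup H]
    [InnerProductSpace ℂ H] [CompleteSpace H] {ρ : H →L[ℂ] H} (hρ : ρ.IsPositive) :
    ∃ s : H →L[ℂ] H, s.adjoint = s ∧ s * s = ρ := by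
  have h0 : 0 ≤ ρ := (ContinuousLinearMap.nonneg_iff_isPositive ρ).2 hρ
  have h1 : IsSelfAdjoint (CFC.sqrt ρ) := IsSelfAdjoint.of_nonneg (CFC.sqrt_nonneg ρ)
  exact ⟨CFC.sqrt ρ, h1.adjoint_eq, CFC.sqrt_mul_sqrt_self ρ h0⟩

/-- A density operator is a sum of rank one projections `∑ₗ ⟨eₗ, ·⟩ eₗ` with
`∑ₗ ‖eₗ‖² < ∞`. -/
theorem exists_decomposition {ρ : Fock n →L[ℂ] Fock n} (hρ : IsDensityOperator ρ) :
    ∃ e : (Fin n → ℕ) → Fock n, (Summable fun l => ‖e l‖ ^ 2) ∧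
      ∀ ψ, HasSum (fun l => ⟪e l, ψ⟫_ℂ • e l) (ρ ψ) := by
  obtain ⟨s, hsa, hss⟩ := hρ.isPositive.exists_sqrt
  refine ⟨fun l => s (ket l), ?_, fun ψ => ?_⟩
  · have h1 : ∀ l, ⟪ket l, ρ (ket l)⟫_ℂ = ((‖s (ket l)‖ ^ 2 : ℝ) : ℂ) := by
      intro l
      rw [← hss, mul_apply_eq_comp, ← ContinuousLinearMap.adjoint_inner_left, hsa,
        inner_self_eq_norm_sq_to_K]
      simp
    have h2 : Summable fun l => ⟪ket l, ρ (ket l)⟫_ℂ := by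
      -- A divergent trace would have the default value `0`, not `1`.
      by_contra hns
      have := hρ.trace_eq_one
      rw [trace, tsum_eq_zero_of_not_summable hns] at this
      exact zero_ne_one this
    simp only [h1] at h2
    exact_mod_cast h2
  · have h1 := (hasSum_ket (s ψ)).mapL s
    rw [← mul_apply_eq_comp, hss] at h1
    have h2 : (fun l => ⟪s (ket l), ψ⟫_ℂ • s (ket l)) = fun l => s ((s ψ) l • ket l) := by
      ext1 l
      rw [map_smul, ← ContinuousLinearMap.adjoint_inner_right, hsa, inner_ket_left]
    rwa [h2]

end TraceClass

/-! ### Expectations of operator products. -/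

section Expectations

/-- The natural domain of a product requires every partial product, read from the right, to stay in
`ℓ²`; these are the suffixes of `w`. -/
theorem mem_domain_ladderProd {w : List (Idx n)} {ψ : Fock n}
    (h : ∀ u, u <:+ w → Memℓp ((u.map ladder).prod (ψ : (Fin n → ℕ) → ℂ)) 2) :
    ∃ hψ : ψ ∈ (ladderProd w).domain,
      (ladderProd w ⟨ψ, hψ⟩ : (Fin n → ℕ) → ℂ) =
        ((w.map ladder).prod : Module.End ℂ ((Fin n → ℕ) → ℂ)) ψ := by
  induction w with
  | nil => exact ⟨trivial, rfl⟩
  | cons k w ih =>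
    obtain ⟨hψ, hw⟩ := ih fun u hu => h u (hu.trans (List.suffix_cons k w))
    have h1 := h (k :: w) (List.suffix_refl _)
    rw [List.map_cons, List.prod_cons, Module.End.mul_apply, ← hw] at h1
    refine ⟨⟨hψ, h1⟩, ?_⟩
    rw [List.map_cons, List.prod_cons, Module.End.mul_apply, ← hw]
    rfl

theorem HasExpectation.unique {ρ : Fock n →L[ℂ] Fock n} {A : Fock n →ₗ.[ℂ] Fock n} {c d : ℂ}
    (h : HasExpectation ρ A c) (h' : HasExpectation ρ A d) : c = d := by
  obtain ⟨T, hT, -, rfl⟩ := h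
  obtain ⟨T', hT', -, rfl⟩ := h'
  congr 1
  ext1 ψ
  obtain ⟨_, h1⟩ := hT ψ
  obtain ⟨_, h2⟩ := hT' ψ
  rw [← h1, ← h2]

theorem HasExpectation.expectation_eq {ρ : Fock n →L[ℂ] Fock n} {A : Fock n →ₗ.[ℂ] Fock n} {c : ℂ}
    (h : HasExpectation ρ A c) : expectation ρ A = c := by
  have h1 : ∃ c, HasExpectation ρ A c := ⟨c, h⟩
  rw [expectation, dif_pos h1]
  exact h1.choose_spec.unique h

theorem hasSum_coe {α : Type*} {f : α → Fock n} {ψ : Fock n} (h : HasSum f ψ) :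
    HasSum (fun i => (f i : (Fin n → ℕ) → ℂ)) (ψ : (Fin n → ℕ) → ℂ) := by
  refine Pi.hasSum.2 fun k => ?_
  have := h.mapL (innerSL ℂ (ket k))
  simpa only [innerSL_apply_apply, inner_ket_left] using this

theorem hasSum_ladder_prod {α : Type*} (w : List (Idx n)) {f : α → (Fin n → ℕ) → ℂ}
    {g : (Fin n → ℕ) → ℂ} (h : HasSum f g) :
    HasSum (fun i => ((w.map ladder).prod : Module.End ℂ ((Fin n → ℕ) → ℂ)) (f i))
      (((w.map ladder).prod : Module.End ℂ ((Fin n → ℕ) → ℂ)) g) := by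
  have hc := continuous_ladder_prod w
  generalize ((w.map ladder).prod : Module.End ℂ ((Fin n → ℕ) → ℂ)) = A at hc ⊢
  exact h.map A.toAddMonoidHom hc

/-- Moments of `ρ = ∑ₗ ⟨eₗ, ·⟩ eₗ`, if the vectors `𝔞_u eₗ` are square summable. -/
theorem hasExpectation_ladderProd {ρ : Fock n →L[ℂ] Fock n} {e : (Fin n → ℕ) → Fock n}
    (he : Summable fun l => ‖e l‖ ^ 2) (hρ : ∀ ψ, HasSum (fun l => ⟪e l, ψ⟫_ℂ • e l) (ρ ψ))
    (w : List (Idx n))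
    (h : ∀ u, u <:+ w → Memℓp (fun p : (Fin n → ℕ) × (Fin n → ℕ) =>
      ((u.map ladder).prod : Module.End ℂ ((Fin n → ℕ) → ℂ)) (e p.1) p.2) 2)
    (Y : lp (fun _ : (Fin n → ℕ) × (Fin n → ℕ) => ℂ) 2)
    (hY : ∀ p, Y p = ((w.map ladder).prod : Module.End ℂ ((Fin n → ℕ) → ℂ)) (e p.1) p.2) :
    HasExpectation ρ (ladderProd w) ⟪lpUncurry e he, Y⟫_ℂ := by
  -- `T = ∑ ⟨e_l, ·⟩ 𝔞_u e_l` converges in norm; coordinatewise it equals `𝔞_u ρ`.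
  have key : ∀ u, u <:+ w → ∃ (y : (Fin n → ℕ) → Fock n) (T : Fock n →L[ℂ] Fock n),
      (Summable fun l => ‖y l‖ ^ 2) ∧ (Summable fun l => ‖e l‖ * ‖y l‖) ∧
      (∀ l, (y l : (Fin n → ℕ) → ℂ) =
        ((u.map ladder).prod : Module.End ℂ ((Fin n → ℕ) → ℂ)) (e l)) ∧
      (∀ ψ, HasSum (fun l => ⟪e l, ψ⟫_ℂ • y l) (T ψ)) ∧
      ∀ ψ, (T ψ : (Fin n → ℕ) → ℂ) =
        ((u.map ladder).prod : Module.End ℂ ((Fin n → ℕ) → ℂ)) (ρ ψ) := by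
    intro u hu
    obtain ⟨y, hy, hys⟩ := exists_of_memℓp_uncurry
      (y := fun l => ((u.map ladder).prod : Module.End ℂ ((Fin n → ℕ) → ℂ)) (e l)) (h u hu)
    have hey : Summable fun l => ‖e l‖ * ‖y l‖ := by
      refine (he.add hys).of_nonneg_of_le (fun l => by positivity) fun l => ?_
      nlinarith [sq_nonneg (‖e l‖ - ‖y l‖), sq_nonneg ‖e l‖, sq_nonneg ‖y l‖]
    obtain ⟨T, hT⟩ := exists_clm_of_summable hey
    refine ⟨y, T, hys, hey, hy, hT, fun ψ => ?_⟩
    have h1 := hasSum_coe (hT ψ)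
    have h2 := hasSum_ladder_prod u (hasSum_coe (hρ ψ))
    have h3 : (fun l => ((⟪e l, ψ⟫_ℂ • y l : Fock n) : (Fin n → ℕ) → ℂ)) = fun l =>
        ((u.map ladder).prod : Module.End ℂ ((Fin n → ℕ) → ℂ))
          ((⟪e l, ψ⟫_ℂ • e l : Fock n) : (Fin n → ℕ) → ℂ) := by
      ext1 l
      rw [lp.coeFn_smul, lp.coeFn_smul, map_smul, hy]
    rw [h3] at h1
    exact h1.unique h2
  obtain ⟨y, T, hys, hey, hy, hT, hTρ⟩ := key w (List.suffix_refl w)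
  refine ⟨T, fun ψ => ?_, isTraceClass_of_hasSum hey hT, ?_⟩
  · obtain ⟨hψ, h1⟩ := mem_domain_ladderProd (w := w) (ψ := ρ ψ) fun u hu => by
      obtain ⟨y', T', -, -, -, -, hT'⟩ := key u hu
      rw [← hT']
      exact (T' ψ).2
    exact ⟨hψ, lp.ext (h1.trans (hTρ ψ).symm)⟩
  · rw [trace_eq_tsum_inner hey hT, (hasSum_inner_lpUncurry he hys).tsum_eq]
    congr 1
    ext p
    exact (congrFun (hy p.1) p.2).trans (hY p).symm

end Expectations

end Fock

/-! ### Derivatives of the Gaussian curve. -/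

section GaussianCurve

/-- The curve `s ↦ exp (a s + b s²)`. -/
def gaussCurve (a b : ℂ) (s : ℝ) : ℂ := Complex.exp (a * s + b * s ^ 2)

theorem contDiff_gaussCurve (a b : ℂ) {N : WithTop ℕ∞} : ContDiff ℝ N (gaussCurve a b) := by
  have h : ContDiff ℝ N fun s : ℝ => (s : ℂ) := Complex.ofRealCLM.contDiff
  exact ((contDiff_const.mul h).add (contDiff_const.mul (h.pow 2))).cexp

theorem hasDerivAt_iteratedDeriv_gaussCurve (a b : ℂ) (m : ℕ) (s : ℝ) :
    HasDerivAt (iteratedDeriv m (gaussCurve a b)) (iteratedDeriv (m + 1) (gaussCurve a b) s) s := by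
  rw [iteratedDeriv_succ]
  exact ((contDiff_gaussCurve a b (N := (m + 1 : ℕ))).differentiable_iteratedDeriv m
    (by exact_mod_cast Nat.lt_succ_self m) s).hasDerivAt

theorem iteratedDeriv_gaussCurve_succ (a b : ℂ) (m : ℕ) (s : ℝ) :
    iteratedDeriv (m + 1) (gaussCurve a b) s =
      (a + 2 * b * s) * iteratedDeriv m (gaussCurve a b) s +
        2 * b * m * iteratedDeriv (m - 1) (gaussCurve a b) s := by
  have hid : ∀ s : ℝ, HasDerivAt (fun s : ℝ => (s : ℂ)) 1 s := fun s =>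
    Complex.ofRealCLM.hasDerivAt
  induction m generalizing s with
  | zero =>
    rw [zero_add, iteratedDeriv_one, iteratedDeriv_zero]
    have h := (((hid s).const_mul a).add (((hid s).pow 2).const_mul b)).cexp
    have h' : HasDerivAt (gaussCurve a b) _ s := h
    rw [h'.deriv, gaussCurve]
    simp
    ring
  | succ m ih =>
    have h1 := hasDerivAt_iteratedDeriv_gaussCurve a b (m + 1) s
    have h2 : HasDerivAt (fun s : ℝ => (a + 2 * b * s) * iteratedDeriv m (gaussCurve a b) s +
        2 * b * m * iteratedDeriv (m - 1) (gaussCurve a b) s)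
        ((2 * b * 1) * iteratedDeriv m (gaussCurve a b) s +
          (a + 2 * b * s) * iteratedDeriv (m + 1) (gaussCurve a b) s +
          2 * b * m * iteratedDeriv (m - 1 + 1) (gaussCurve a b) s) s :=
      ((((hid s).const_mul (2 * b)).const_add a).mul
        (hasDerivAt_iteratedDeriv_gaussCurve a b m s)).add
        ((hasDerivAt_iteratedDeriv_gaussCurve a b (m - 1) s).const_mul _)
    have h3 := h1.unique (h2.congr_of_eventuallyEq (Eventually.of_forall ih))
    rw [h3, Nat.add_sub_cancel]
    -- For `m = 0` the order `m - 1 + 1` is wrong, but its coefficient is `0`.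
    rcases m with _ | m
    · simp; ring
    · rw [Nat.add_sub_cancel]; push_cast; ring

theorem tendsto_centralDiff_of_contDiff {E : Type*} [NormedAddCommGroup E] [NormedSpace ℝ E]
    {f : ℝ → E} {m : ℕ} (hf : ContDiff ℝ m f) :
    Tendsto (fun t : ℝ => ((2 * t) ^ m)⁻¹ • centralDiff m f t) (𝓝[≠] 0)
      (𝓝 (iteratedDeriv m f 0)) := by
  have h := tendsto_centralDiff m f (fun k => (k.factorial : ℝ)⁻¹ • iteratedDeriv k f 0) ?_
  · rwa [smul_inv_smul₀ (by exact_mod_cast m.factorial_ne_zero)] at h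
  · have h1 := taylor_isLittleO_univ (x₀ := 0) hf
    simp only [taylor_within_apply, sub_zero, iteratedDerivWithin_univ] at h1
    refine h1.congr_left fun s => ?_
    congr 1
    refine Finset.sum_congr rfl fun k _ => ?_
    rw [smul_smul, mul_comm]

end GaussianCurve

namespace Fock

variable {n : ℕ}

/-! ### Moments of powers of a field. -/

section Moments

theorem norm_weyl_apply (z : Fin n → ℂ) (ψ : Fock n) : ‖weyl z ψ‖ = ‖ψ‖ :=
  LinearIsometry.norm_map _ ψ

variable {ρ : Fock n →L[ℂ] Fock n} {e : (Fin n → ℕ) → Fock n}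

theorem hasSum_charFun (he : Summable fun l => ‖e l‖ ^ 2)
    (hρ : ∀ ψ, HasSum (fun l => ⟪e l, ψ⟫_ℂ • e l) (ρ ψ)) (z : Fin n → ℂ) :
    HasSum (fun l => ⟪e l, weyl z (e l)⟫_ℂ) (charFun ρ z) := by
  have h1 : ∀ ψ, HasSum (fun l => ⟪e l, ψ⟫_ℂ • weyl z (e l)) ((weyl z ∘L ρ) ψ) := by
    intro ψ
    have := (hρ ψ).mapL (weyl z)
    simp only [map_smul] at this
    exact this
  have h2 : Summable fun l => ‖e l‖ * ‖weyl z (e l)‖ := by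
    simpa only [norm_weyl_apply, ← pow_two] using he
  have h3 : Summable fun l => ‖weyl z (e l)‖ ^ 2 := by simpa only [norm_weyl_apply] using he
  rw [charFun, trace_eq_tsum_inner h2 h1]
  exact (hasSum_inner_lpUncurry he h3).summable.hasSum

theorem hasSum_inner_weylDiff_pow (he : Summable fun l => ‖e l‖ ^ 2)
    (hρ : ∀ ψ, HasSum (fun l => ⟪e l, ψ⟫_ℂ • e l) (ρ ψ)) (z : Fin n → ℂ) (m : ℕ) (t : ℝ) :
    HasSum (fun l => ⟪e l, (weylDiff (t • z) ^ m) (e l)⟫_ℂ)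
      (centralDiff m (fun s => charFun ρ (s • z)) t) := by
  simp only [weylDiff_pow_apply, centralDiff, inner_sum]
  refine hasSum_sum fun k _ => ?_
  simp only [real_smul_eq, inner_smul_right]
  exact (hasSum_charFun he hρ _).mul_left _

/-- If the central differences of the characteristic function in direction `z` converge, then the
powers of the field operator have moments, and these are the limits. -/
theorem exists_moment_field_pow (he : Summable fun l => ‖e l‖ ^ 2)
    (hρ : ∀ ψ, HasSum (fun l => ⟪e l, ψ⟫_ℂ • e l) (ρ ψ)) (z : Fin n → ℂ) {L : ℕ → ℂ}
    (hL : ∀ m, Tendsto (fun t : ℝ => ((2 * t) ^ m)⁻¹ •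
      centralDiff m (fun s => charFun ρ (s • z)) t) (𝓝[≠] 0) (𝓝 (L m))) (m : ℕ) :
    ∃ Y : lp (fun _ : (Fin n → ℕ) × (Fin n → ℕ) => ℂ) 2,
      (∀ p, Y p = (field z ^ m) (e p.1) p.2) ∧
      ⟪lpUncurry e he, Y⟫_ℂ = (Complex.I ^ m)⁻¹ * L m := by
  set y : ℝ → (Fin n → ℕ) → Fock n := fun t l =>
    ((2 * Complex.I * t) ^ m)⁻¹ • (weylDiff (t • z) ^ m) (e l) with hy
  have hys : ∀ t, Summable fun l => ‖y t l‖ ^ 2 := by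
    intro t
    refine (he.mul_left ((‖((2 * Complex.I * t : ℂ) ^ m)⁻¹‖ *
      ‖weylDiff (t • z) ^ m‖) ^ 2)).of_nonneg_of_le (fun l => by positivity) fun l => ?_
    rw [← mul_pow, hy]
    simp only [norm_smul]
    exact pow_le_pow_left₀ (by positivity)
      ((mul_le_mul_of_nonneg_left ((weylDiff (t • z) ^ m).le_opNorm (e l))
        (norm_nonneg _)).trans_eq (mul_assoc _ _ _).symm) 2
  set F : ℝ → lp (fun _ : (Fin n → ℕ) × (Fin n → ℕ) => ℂ) 2 := fun t => lpUncurry (y t) (hys t)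
    with hF
  have hinner : ∀ t, ⟪lpUncurry e he, F t⟫_ℂ = (Complex.I ^ m)⁻¹ *
      (((2 * t) ^ m)⁻¹ • centralDiff m (fun s => charFun ρ (s • z)) t) := by
    intro t
    refine (hasSum_inner_lpUncurry he (hys t)).unique ?_
    have h := (hasSum_inner_weylDiff_pow he hρ z m t).mul_left ((2 * Complex.I * t : ℂ) ^ m)⁻¹
    have h1 : (Complex.I ^ m)⁻¹ *
        (((2 * t) ^ m)⁻¹ • centralDiff m (fun s => charFun ρ (s • z)) t) =
        ((2 * Complex.I * t : ℂ) ^ m)⁻¹ * centralDiff m (fun s => charFun ρ (s • z)) t := by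
      rw [Complex.real_smul]
      push_cast
      rw [mul_pow, mul_pow, mul_pow, mul_inv, mul_inv, mul_inv]
      ring
    simp only [hy, inner_smul_right]
    rw [h1]
    exact h
  -- Skew-adjointness moves all differences to one side, so bounding order `m` needs the limit at
  -- order `2 * m`.
  have hnorm : ∀ t, ‖F t‖ ^ 2 =
      ‖((2 * t) ^ (2 * m))⁻¹ • centralDiff (2 * m) (fun s => charFun ρ (s • z)) t‖ := by
    intro t
    have h1 : ⟪F t, F t⟫_ℂ = (-1) ^ m *
        (((2 * t) ^ (2 * m))⁻¹ • centralDiff (2 * m) (fun s => charFun ρ (s • z)) t) := by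
      refine (hasSum_inner_lpUncurry (hys t) (hys t)).unique ?_
      have h := (hasSum_inner_weylDiff_pow he hρ z (2 * m) t).mul_left
        ((-1) ^ m * ((2 * t : ℂ) ^ (2 * m))⁻¹)
      have h1 : (fun l => ⟪y t l, y t l⟫_ℂ) = fun l =>
          (-1) ^ m * ((2 * t : ℂ) ^ (2 * m))⁻¹ * ⟪e l, (weylDiff (t • z) ^ (2 * m)) (e l)⟫_ℂ := by
        ext1 l
        simp only [hy]
        rw [inner_smul_left, inner_smul_right, ← ContinuousLinearMap.adjoint_inner_right,
          adjoint_weylDiff_pow, smul_apply, inner_smul_right, ← mul_apply_eq_comp, ← pow_add,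
          ← two_mul]
        simp only [map_inv₀, map_pow, map_mul, Complex.conj_I, Complex.conj_ofReal,
          Complex.conj_ofNat]
        have h2 : ((2 * -Complex.I * t : ℂ) ^ m)⁻¹ * ((2 * Complex.I * t : ℂ) ^ m)⁻¹ =
            ((2 * t : ℂ) ^ (2 * m))⁻¹ := by
          rw [← mul_inv, ← mul_pow, pow_mul]
          congr 2
          linear_combination (-4 * t ^ 2 : ℂ) * Complex.I_mul_I
        linear_combination ((-1) ^ m * ⟪e l, (weylDiff (t • z) ^ (2 * m)) (e l)⟫_ℂ) * h2
      have h2 : (-1) ^ m *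
          (((2 * t) ^ (2 * m))⁻¹ • centralDiff (2 * m) (fun s => charFun ρ (s • z)) t) =
          (-1) ^ m * ((2 * t : ℂ) ^ (2 * m))⁻¹ *
            centralDiff (2 * m) (fun s => charFun ρ (s • z)) t := by
        rw [Complex.real_smul]
        push_cast
        ring
      rw [h1, h2]
      exact h
    have h2 : ‖⟪F t, F t⟫_ℂ‖ = ‖F t‖ ^ 2 := by
      rw [inner_self_eq_norm_sq_to_K]; simp
    rw [← h2, h1, norm_mul]
    simp
  have hbound : ∀ᶠ t in 𝓝[≠] (0 : ℝ), ‖F t‖ ≤ Real.sqrt (‖L (2 * m)‖ + 1) := by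
    filter_upwards [(hL (2 * m)).norm.eventually (gt_mem_nhds (lt_add_one ‖L (2 * m)‖))] with t ht
    exact Real.le_sqrt_of_sq_le ((hnorm t).trans_lt ht).le
  have hpt : ∀ p : (Fin n → ℕ) × (Fin n → ℕ),
      Tendsto (fun t => F t p) (𝓝[≠] 0) (𝓝 ((field z ^ m) (e p.1) p.2)) :=
    fun p => tendsto_weylDiff_apply z m (e p.1) p.2
  have hmem := memℓp_two_of_tendsto hbound hpt
  refine ⟨⟨_, hmem⟩, fun p => rfl, ?_⟩
  -- Boundedness and entrywise convergence give weak convergence; the inner products with `e` are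
  -- the difference quotients of order `m`.
  refine tendsto_nhds_unique (tendsto_inner_of_tendsto hbound (f := ⟨_, hmem⟩) hpt (lpUncurry e he)) ?_
  simp only [hinner]
  exact (hL m).const_mul _

end Moments

/-! ### Moments of Gaussian states. -/

section Gaussian

theorem sum_smul_commutator {σ R : Type*} [Fintype σ] [Ring R] [Algebra ℂ R] {p : σ → R}
    {c : σ → σ → ℂ} (h : ∀ k l, p k * p l = p l * p k + algebraMap ℂ R (c k l)) (v w : σ → ℂ) :
    (∑ k, v k • p k) * ∑ l, w l • p l = (∑ l, w l • p l) * (∑ k, v k • p k) +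
      algebraMap ℂ R (∑ k, ∑ l, v k * w l * c k l) := by
  have h1 : (∑ l, w l • p l) * (∑ k, v k • p k) = ∑ k, ∑ l, (v k * w l) • (p l * p k) := by
    rw [Finset.sum_mul_sum, Finset.sum_comm]
    refine Finset.sum_congr rfl fun k _ => Finset.sum_congr rfl fun l _ => ?_
    rw [smul_mul_smul_comm, mul_comm]
  rw [h1, Finset.sum_mul_sum, map_sum, ← Finset.sum_add_distrib]
  refine Finset.sum_congr rfl fun k _ => ?_
  rw [map_sum, ← Finset.sum_add_distrib]
  refine Finset.sum_congr rfl fun l _ => ?_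
  rw [smul_mul_smul_comm, h, smul_add, map_mul, Algebra.smul_def (v k * w l) (algebraMap ℂ R _)]

/-- Products of ladder-type operators with scalar commutators are linear combinations of powers of
the fields `∑ₖ z̄ₖ pₖ`. -/
theorem list_prod_mem_span_pow {R : Type*} [Ring R] [Algebra ℂ R] {p : Idx n → R}
    {c : Idx n → Idx n → ℂ} (h : ∀ k l, p k * p l = p l * p k + algebraMap ℂ R (c k l))
    (w : List (Idx n)) :
    (w.map p).prod ∈
      Submodule.span ℂ {x | ∃ (z : Fin n → ℂ) (m : ℕ), x = (∑ k, bar z k • p k) ^ m} := by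
  set L : (Fin n → ℂ) → R := fun z => ∑ k, bar z k • p k with hL
  have hadd : ∀ (v w : Fin n → ℂ) (t : ℝ), L (v + t • w) = L v + (t : ℂ) • L w := by
    intro v w t
    simp only [hL, bar_add_smul, Pi.add_apply, Pi.smul_apply, add_smul, Finset.sum_add_distrib,
      Finset.smul_sum, smul_smul, smul_eq_mul]
  have hcomm : ∀ v w, ∃ c : ℂ, L v * L w = L w * L v + algebraMap ℂ R c := fun v w =>
    ⟨_, sum_smul_commutator h (bar v) (bar w)⟩
  -- `L e_j` and `L (i e_j)` are the sum of `p_j` and its partner and `i` times their difference, so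
  -- both are recovered.
  have hp : ∀ k, ∃ (z z' : Fin n → ℂ) (a : ℂ), p k = (1 / 2 : ℂ) • L z + a • L z' := by
    have h1 : ∀ j (b : ℂ), L (Pi.single j b) = b • p (Sum.inl j) + conj b • p (Sum.inr j) := by
      intro j b
      simp only [hL, Fintype.sum_sum_type, bar, Sum.elim_inl, Sum.elim_inr]
      congr 1
      · rw [Finset.sum_eq_single j] <;> simp +contextual
      · rw [Finset.sum_eq_single j] <;> simp +contextual
    rintro (j | j)
    · refine ⟨Pi.single j 1, Pi.single j Complex.I, -(Complex.I / 2), ?_⟩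
      rw [h1, h1, map_one, Complex.conj_I, smul_add, smul_add, smul_smul, smul_smul, smul_smul,
        smul_smul,
        show -(Complex.I / 2) * Complex.I = 1 / 2 by linear_combination (-1 / 2) * Complex.I_mul_I,
        show -(Complex.I / 2) * -Complex.I = -(1 / 2) by
          linear_combination (1 / 2) * Complex.I_mul_I]
      module
    · refine ⟨Pi.single j 1, Pi.single j Complex.I, Complex.I / 2, ?_⟩
      rw [h1, h1, map_one, Complex.conj_I, smul_add, smul_add, smul_smul, smul_smul, smul_smul,
        smul_smul,
        show (Complex.I / 2) * Complex.I = -(1 / 2) by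
          linear_combination (1 / 2) * Complex.I_mul_I,
        show (Complex.I / 2) * -Complex.I = 1 / 2 by
          linear_combination (-1 / 2) * Complex.I_mul_I]
      module
  induction w with
  | nil => exact Submodule.subset_span ⟨0, 0, by simp⟩
  | cons k w ih =>
    obtain ⟨z, z', a, hk⟩ := hp k
    rw [List.map_cons, List.prod_cons, hk, add_mul, smul_mul_assoc, smul_mul_assoc]
    exact add_mem (Submodule.smul_mem _ _ (mul_mem_span_pow hadd hcomm z ih))
      (Submodule.smul_mem _ _ (mul_mem_span_pow hadd hcomm z' ih))

/-- The matrix of second central moments of a Gaussian state with covariance matrix `C`. -/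
def orderedCov (C : Matrix (Idx n) (Idx n) ℂ) : Matrix (Idx n) (Idx n) ℂ :=
  C - (1 / 2 : ℂ) • Matrix.J (Fin n) ℂ

theorem J_apply_swap (k l : Idx n) : Matrix.J (Fin n) ℂ l k = -Matrix.J (Fin n) ℂ k l := by
  have := congrFun (congrFun (Matrix.J_transpose (Fin n) ℂ) k) l
  simpa using this

/-- As `C` is symmetric, the antisymmetric part of `orderedCov C` is `-½ J`. By `wickOp_commutator`
the Wick operators then have the commutators of the ladder operators. -/
theorem orderedCov_sub_swap {C : Matrix (Idx n) (Idx n) ℂ} (hC : C.IsSymm) (k l : Idx n) :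
    orderedCov C k l - orderedCov C l k = -Matrix.J (Fin n) ℂ k l := by
  simp only [orderedCov, Matrix.sub_apply, Matrix.smul_apply, smul_eq_mul, J_apply_swap k l,
    hC.apply k l]
  ring

/-- The antisymmetric `J` does not contribute to a quadratic form, so the ordering correction is
invisible to powers of a single field. -/
theorem dotProduct_orderedCov_mulVec (C : Matrix (Idx n) (Idx n) ℂ) (v : Idx n → ℂ) :
    v ⬝ᵥ (orderedCov C).mulVec v = v ⬝ᵥ C.mulVec v := by
  have h : v ⬝ᵥ (Matrix.J (Fin n) ℂ).mulVec v = 0 := by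
    have h1 : v ⬝ᵥ (Matrix.J (Fin n) ℂ).mulVec v = -(v ⬝ᵥ (Matrix.J (Fin n) ℂ).mulVec v) := by
      conv_lhs => rw [Matrix.dotProduct_mulVec, ← Matrix.mulVec_transpose, Matrix.J_transpose,
        dotProduct_comm]
      rw [Matrix.neg_mulVec, dotProduct_neg]
    exact self_eq_neg.1 h1
  rw [orderedCov, Matrix.sub_mulVec, dotProduct_sub, Matrix.smul_mulVec, dotProduct_smul, h,
    smul_zero, sub_zero]

theorem IsGaussian.charFun_smul {ρ : Fock n →L[ℂ] Fock n} {μ : Idx n → ℂ}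
    {C : Matrix (Idx n) (Idx n) ℂ} (hρ : IsGaussian ρ μ C) (z : Fin n → ℂ) (s : ℝ) :
    charFun ρ (s • z) =
      gaussCurve (Complex.I * (bar z ⬝ᵥ μ)) (-(1 / 2) * (bar z ⬝ᵥ C.mulVec (bar z))) s := by
  rw [hρ.charFun_eq, gaussCurve, bar_smul]
  simp only [Matrix.mulVec_smul, smul_dotProduct, dotProduct_smul, smul_eq_mul]
  congr 1
  linear_combination (1 / 2 * (s : ℂ) ^ 2 * (bar z ⬝ᵥ C.mulVec (bar z))) * Complex.I_mul_I

/-- Both sides obey the same two-term recursion, since `a = i v·μ` and `2b = i² v·Cv`. -/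
theorem iteratedDeriv_gaussCurve_eq_vacuum (μ v : Idx n → ℂ) (C : Matrix (Idx n) (Idx n) ℂ)
    (m : ℕ) :
    (Complex.I ^ m)⁻¹ * iteratedDeriv m
      (gaussCurve (Complex.I * (v ⬝ᵥ μ)) (-(1 / 2) * (v ⬝ᵥ C.mulVec v))) 0 =
      vacuum ((∑ k, v k • wickOp μ (orderedCov C) k) ^ m) := by
  induction m using Nat.strong_induction_on with
  | _ m ih =>
  rcases m with _ | m
  · simp [gaussCurve, vacuum_one]
  · rw [vacuum_sum_wickOp_pow_succ, iteratedDeriv_gaussCurve_succ, dotProduct_orderedCov_mulVec,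
      ← ih m (by omega), ← ih (m - 1) (by omega)]
    rcases m with _ | m
    · simp only [zero_add, pow_one, pow_zero, inv_one, one_mul, Complex.inv_I, Nat.cast_zero,
        mul_zero, zero_mul, add_zero, Complex.ofReal_zero]
      linear_combination (-((v ⬝ᵥ μ) * iteratedDeriv 0 (gaussCurve (Complex.I * (v ⬝ᵥ μ))
        (-(1 / 2) * (v ⬝ᵥ C.mulVec v))) 0)) * Complex.I_mul_I
    · have h1 : (Complex.I ^ (m + 1 + 1))⁻¹ = -(Complex.I ^ m)⁻¹ := by
        rw [pow_succ, pow_succ, mul_assoc, Complex.I_mul_I]; simp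
      have h2 : (Complex.I ^ (m + 1 + 1))⁻¹ * Complex.I = (Complex.I ^ (m + 1))⁻¹ := by
        rw [pow_succ _ (m + 1), mul_inv, mul_assoc, inv_mul_cancel₀ Complex.I_ne_zero, mul_one]
      rw [Nat.add_sub_cancel, ← h2, mul_add, h1]
      push_cast
      ring

/-- All products of ladder operators have an expectation in a Gaussian state. -/
theorem IsGaussian.hasExpectation {ρ : Fock n →L[ℂ] Fock n} {μ : Idx n → ℂ}
    {C : Matrix (Idx n) (Idx n) ℂ} (hρ : IsGaussian ρ μ C) (w : List (Idx n)) :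
    HasExpectation ρ (ladderProd w) (vacuum (w.map (wickOp μ (orderedCov C))).prod) := by
  obtain ⟨e, he, hρe⟩ := exists_decomposition hρ.isDensityOperator
  let p : Idx n → Module.End ℂ ((Fin n → ℕ) → ℂ) × Module.End ℂ (MvPolynomial (Idx n) ℂ) :=
    fun k => (ladder k, wickOp μ (orderedCov C) k)
  -- Pairs (operator on sequences, Wick operator) for which the moment exists and equals the vacuum
  -- expectation. The condition is linear in the pair, so powers of fields suffice.
  let S : Submodule ℂ
      (Module.End ℂ ((Fin n → ℕ) → ℂ) × Module.End ℂ (MvPolynomial (Idx n) ℂ)) :=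
    { carrier := {x | ∃ Y : lp (fun _ : (Fin n → ℕ) × (Fin n → ℕ) => ℂ) 2,
        (∀ p, Y p = x.1 (e p.1) p.2) ∧ ⟪lpUncurry e he, Y⟫_ℂ = vacuum x.2}
      add_mem' := by
        rintro x x' ⟨Y, hY, h⟩ ⟨Y', hY', h'⟩
        exact ⟨Y + Y', fun p => by simp [hY, hY'], by simp [h, h']⟩
      zero_mem' := ⟨0, fun p => by simp, by simp⟩
      smul_mem' := by
        rintro c x ⟨Y, hY, h⟩
        exact ⟨c • Y, fun p => by simp [hY], by simp [h]⟩ }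
  have hcomm : ∀ k l, p k * p l = p l * p k + algebraMap ℂ _ (-(Matrix.J (Fin n) ℂ k l)) := by
    intro k l
    refine Prod.ext (ladder_commutator k l) ?_
    exact (wickOp_commutator μ (orderedCov C) k l).trans (by
      rw [orderedCov_sub_swap hρ.isSymm]; rfl)
  have hfst : ∀ u : List (Idx n), (u.map p).prod.1 = (u.map ladder).prod := fun u => by
    have := map_list_prod (RingHom.fst (Module.End ℂ ((Fin n → ℕ) → ℂ))
      (Module.End ℂ (MvPolynomial (Idx n) ℂ))) (u.map p)
    rw [List.map_map] at this
    exact this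
  have hsnd : ∀ u : List (Idx n), (u.map p).prod.2 = (u.map (wickOp μ (orderedCov C))).prod :=
    fun u => by
      have := map_list_prod (RingHom.snd (Module.End ℂ ((Fin n → ℕ) → ℂ))
        (Module.End ℂ (MvPolynomial (Idx n) ℂ))) (u.map p)
      rw [List.map_map] at this
      exact this
  have hS : ∀ u : List (Idx n), (u.map p).prod ∈ S := by
    intro u
    refine Submodule.span_le.2 ?_ (list_prod_mem_span_pow hcomm u)
    rintro _ ⟨z, m, rfl⟩
    have h1 : ∑ k, bar z k • p k =
        (field z, ∑ k, bar z k • wickOp μ (orderedCov C) k) := by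
      refine Prod.ext ?_ ?_
      · rw [Prod.fst_sum]; rfl
      · rw [Prod.snd_sum]; rfl
    have hL := fun m => tendsto_centralDiff_of_contDiff (m := m) (contDiff_gaussCurve
      (Complex.I * (bar z ⬝ᵥ μ)) (-(1 / 2) * (bar z ⬝ᵥ C.mulVec (bar z))))
    simp only [← funext (hρ.charFun_smul z)] at hL
    obtain ⟨Y, hY, hYe⟩ := exists_moment_field_pow he hρe z hL m
    rw [h1]
    refine ⟨Y, hY, hYe.trans ?_⟩
    rw [funext (hρ.charFun_smul z)]
    exact iteratedDeriv_gaussCurve_eq_vacuum μ (bar z) C m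
  obtain ⟨Y, hY, hYe⟩ := hS w
  rw [hfst] at hY
  rw [hsnd] at hYe
  rw [← hYe]
  -- The domain condition on suffixes holds because `hS` covers every word.
  refine hasExpectation_ladderProd he hρe w (fun u _ => ?_) Y hY
  obtain ⟨Y', hY', -⟩ := hS u
  rw [hfst] at hY'
  rw [← funext hY']
  exact Y'.2

end Gaussian

end Fock

end

theorem corollary2 {n : ℕ} (ρ : Fock n →L[ℂ] Fock n) (μ : Fock.Idx n → ℂ)
    (C : Matrix (Fock.Idx n) (Fock.Idx n) ℂ) (hρ : Fock.IsGaussian ρ μ C) :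
    Fock.mean ρ = μ ∧
    Fock.secondCentralMoments ρ = C - (1 / 2 : ℂ) • Matrix.J (Fin n) ℂ ∧
    ∀ (κ : ℕ → Fock.Idx n) (I : Finset ℕ),
      Fock.HasExpectation ρ (Fock.ladderSet κ I)
        (∑ I₁ ∈ I.powerset,
          Fock.vecSet μ κ I₁ * Fock.pairingSum (Fock.secondCentralMoments ρ) κ (I \ I₁)) := by
  have hmean : Fock.mean ρ = μ := by
    ext k
    -- Words of length one and two, evaluated in the polynomial model, identify `μ` and `D`.
    rw [Fock.mean, (hρ.hasExpectation [k]).expectation_eq]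
    simp [Fock.vacuum_apply, Fock.wickOp_apply]
  have hcov : Fock.secondCentralMoments ρ = Fock.orderedCov C := by
    ext k l
    rw [Fock.secondCentralMoments, Matrix.of_apply, (hρ.hasExpectation [k, l]).expectation_eq,
      hmean]
    simp [Fock.vacuum_apply, Fock.wickOp_apply, Fock.contraction_X]
  refine ⟨hmean, hcov, fun κ I => ?_⟩
  rw [hcov, ← Fock.vacuum_wickSet]
  exact hρ.hasExpectation _
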